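/- Graphs are finite multigraphs (loops and parallel edges are allowed). A graft is a pair $(G,T)$ of a graph $G$ and a set $T\subseteq V(G)$ such that every connected component of $G$ contains an even number of vertices of $T$. A join of $(G,T)$ is a set $F\subseteq E(G)$ such that $|\delta_G(v)\cap F|$ is odd for every $v\in T$ and even for every $v\in V(G)\setminus T$, where $\delta_G(X)$ denotes the set of edges between $X$ and $V(G)\setminus X$. A minimum join is a join with the fewest edges. It is connected if it is nonempty and the subgraph of $G$ consisting of its edges and their ends is connected. A set of edges covers $v$ if it contains an edge incident to $v$. The classes $\mathcal R(r,B)$ of grafts (rakes with head $r$ and tooth set $B$) are defined inductively: 1. Let $r\notin B$, let $V(H)=\{r\}\cup B$, and let $H$ be a star with centre $r$ and set of leaves $B$, possibly with parallel edges: every edge of $H$ joins $r$ to a vertex of $B$, and $r$ is adjacent to every vertex of $B$ (here $B=\emptyset$ is allowed). Let $T=V(H)$ if $|V(H)|$ is even, and $T=V(H)\setminus\{r\}$ otherwise. Then $(H,T)\in\mathcal R(r,B)$. 2. If $(G,T)\in\mathcal R(r,B)$ and $\hat G$ arises from $G$ by adding a new vertex $x\notin V(G)$ and a nonempty set of edges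 between $x$ and $B$, then $(\hat G,T)\in\mathcal R(r,B)$. 3. If $(G,T)\in\mathcal R(r,B)$ and $\hat G$ arises from $G$ by adding a set of edges with both ends in $V(G)\setminus B$, then $(\hat G,T)\in\mathcal R(r,B)$. Gluing sum. Let $(G_0,T_0)$ be a connected graft, let $S\subseteq T_0$ be a nonempty stable set, and let $e_s\in\delta_{G_0}(s)$ for each $s\in S$. Let $(G_s,T_s)$, $s\in S$, be mutually disjoint grafts, each disjoint from $(G_0,T_0)$, and let $r_s\in A_s\subseteq V(G_s)$. Let $f_s:\delta_{G_0}(s)\to A_s$ be maps with $f_s(e_s)=r_s$. The corresponding gluing sum is $(G,T)$, where $V(G)=(V(G_0)\setminus S)\cup\bigcup_{s\in S}V(G_s)$ and $T=(T_0\setminus S)\cup\bigcup_{s\in S}(T_s\,\Delta\,\{r_s\})$. The edges of $G$ are the edges of $G_0$ with no end in $S$, all edges of the graphs $G_s$, and, for every $s\in S$ and every edge $e\in\delta_{G_0}(s)$ joining $x\in V(G_0)\setminus S$ and $s$, an edge joining $x$ and $f_s(e)$. The classes $\mathcal P(r,A)$ of grafts are defined inductively: 1. If $(G,T)\in\mathcal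 R(r,B)$, then $(G,T)\in\mathcal P(r,V(G)\setminus B)$. 2. Let $(G,T)\in\mathcal R(r,B)$, let $e_b$ be an edge of $G$ between $r$ and $b$ for each $b\in B$, and let $(H_b,T_b)\in\mathcal P(r_b,A_b)$, $b\in B$, be mutually disjoint grafts that are also disjoint from $(G,T)$. Then every gluing sum of $(G,T)$, with $S=B$ and the edges $e_b$, and the grafts $(H_b,T_b)$, with the sets $A_b$ and the vertices $r_b$, is a member of $\mathcal P(r,V(G)\setminus B)$. Theorem. Let $(G,T)$ be a graft with $T\neq\emptyset$ and let $r\in V(G)$. The following are equivalent: (i) $(G,T)$ has a connected minimum join that covers $r$. (ii) $(G,T)\in\mathcal P(r,A)$ for some $A\subseteq V(G)$ with $r\in A$; or there are a set $A$, a graft $(G',T)\in\mathcal P(r,A)$ with $r\in A\subseteq V(G')$, and a graft $(H,\emptyset)$ with $V(H)\cap V(G')=\emptyset$ such that $G$ is obtained from the disjoint union of $G'$ and $H$ by adding a set of edges between $A$ and $V(H)$. -/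

import Mathlib

open scoped Graph

/-! ### Multigraphs: edge sets, connectedness -/

namespace Graph

variable {α β : Type*}

/-- `E_G[X, Y]`: the edges with one end in `X` and the other end in `Y`.
In particular `E_G[X, X]` is the set of edges that span `X`. -/
def edgesBetween (G : Graph α β) (X Y : Set α) : Set β :=
  {e | ∃ x ∈ X, ∃ y ∈ Y, G.IsLink e x y}

/-- `δ_G(X) = E_G[X, V(G) \ X]`. A loop belongs to no `δ_G(X)`. -/
def cut (G : Graph α β) (X : Set α) : Set β :=
  G.edgesBetween X (V(G) \ X)

/-- The vertex set of the connected component of `G` that contains the vertex `x`. -/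
def componentOf (G : Graph α β) (x : α) : Set α :=
  {y | y ∈ V(G) ∧ Relation.ReflTransGen G.Adj x y}

/-- A graph is connected if it has a vertex and any two vertices are joined by a walk. -/
def IsConnected (G : Graph α β) : Prop :=
  V(G).Nonempty ∧ ∀ x ∈ V(G), ∀ y ∈ V(G), Relation.ReflTransGen G.Adj x y

/-- A set `S` of vertices is stable if no edge (in particular no loop) has both ends in `S`. -/
def IsStable (G : Graph α β) (S : Set α) : Prop :=
  S ⊆ V(G) ∧ G.edgesBetween S S = ∅

/-- A set `F` of edges covers a vertex `v` if some edge of `F` is incident to `v`. -/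
def Covers (G : Graph α β) (F : Set β) (v : α) : Prop :=
  ∃ e ∈ F, G.Inc e v

/-- The subgraph of `G` determined by a set `F` of edges:
its edges are those of `F`, its vertices are the ends of the edges of `F`. -/
def determinedBy (G : Graph α β) (F : Set β) : Graph α β :=
  (G.restrict F).induce {v | G.Covers F v}

end Graph

/-! ### Grafts and joins -/

/-- A graft: a finite multigraph together with a set `T` of vertices such that every
connected component contains an even number of vertices from `T`. -/
structure Graft (α β : Type*) where
  /-- The underlying multigraph. -/
  graph : Graph α β
  /-- The distinguished set of vertices. -/
  T : Set α
  finite_vertexSet : V(graph).Finite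
  finite_edgeSet : E(graph).Finite
  T_subset : T ⊆ V(graph)
  even_component : ∀ x ∈ V(graph), Even (T ∩ graph.componentOf x).ncard

namespace Graft

variable {α β : Type*}

/-- `F` is a join of `(G, T)`: an edge set such that `|δ_G(v) ∩ F|` is odd for `v ∈ T`
and even for the other vertices `v`. -/
def IsJoin (G : Graft α β) (F : Set β) : Prop :=
  F ⊆ E(G.graph) ∧
    (∀ v ∈ G.T, Odd (G.graph.cut {v} ∩ F).ncard) ∧
    (∀ v ∈ V(G.graph) \ G.T, Even (G.graph.cut {v} ∩ F).ncard)

/-- A join with the minimum number of edges. -/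
def IsMinimumJoin (G : Graft α β) (F : Set β) : Prop :=
  G.IsJoin F ∧ ∀ F' : Set β, G.IsJoin F' → F.ncard ≤ F'.ncard

/-- A minimum join that determines a connected subgraph; the empty set is not connected. -/
def IsConnectedMinimumJoin (G : Graft α β) (F : Set β) : Prop :=
  G.IsMinimumJoin F ∧ F.Nonempty ∧ (G.graph.determinedBy F).IsConnected

/-! ### The classes `R(r, B)` and `P(r, A)` -/

/-- `MemR r B G` means `G ∈ R(r, B)`. -/
inductive MemR (r : α) (B : Set α) : Graft α β → Prop
  /-- A star with centre `r` and set of leaves `B`: the pairs of adjacent vertices are exactly the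
  pairs `r, b` with `b ∈ B`, where parallel edges are allowed. -/
  | star (G : Graft α β)
      (hr : r ∉ B)
      (hV : V(G.graph) = {r} ∪ B)
      (hE : E(G.graph) = G.graph.edgesBetween {r} B)
      (hadj : ∀ b ∈ B, G.graph.Adj r b)
      (heven : Even V(G.graph).ncard → G.T = V(G.graph))
      (hodd : ¬ Even V(G.graph).ncard → G.T = V(G.graph) \ {r}) :
      MemR r B G
  /-- Adding a new vertex `x` and a nonempty set of edges between `x` and `B`. -/
  | addVertex (G G' : Graft α β) (x : α)
      (hG : MemR r B G)
      (hx : x ∉ V(G.graph))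
      (hle : G.graph ≤ G'.graph)
      (hV : V(G'.graph) = V(G.graph) ∪ {x})
      (hne : (E(G'.graph) \ E(G.graph)).Nonempty)
      (hE : E(G'.graph) \ E(G.graph) ⊆ G'.graph.edgesBetween {x} B)
      (hT : G'.T = G.T) :
      MemR r B G'
  /-- Adding a set of edges that span `V(G) \ B`. -/
  | addEdges (G G' : Graft α β)
      (hG : MemR r B G)
      (hle : G.graph ≤ G'.graph)
      (hV : V(G'.graph) = V(G.graph))
      (hE : E(G'.graph) \ E(G.graph) ⊆
        G'.graph.edgesBetween (V(G.graph) \ B) (V(G.graph) \ B))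
      (hT : G'.T = G.T) :
      MemR r B G'

/-- `IsGluingSum G₀ S ε H A ρ G` means that `G` is a gluing sum
`(G₀, T₀; S, {ε s : s ∈ S}) ⊕ ⋃ s ∈ S, (H s, T s; A s, ρ s)`. The values of `ε`, `H`, `A`, `ρ`
outside `S` are irrelevant. An edge of `G₀` between `x ∉ S` and `s ∈ S` keeps its name in `G`,
where it joins `x` and `f s e`. -/
structure IsGluingSum (G₀ : Graft α β) (S : Set α) (ε : α → β) (H : α → Graft α β)
    (A : α → Set α) (ρ : α → α) (G : Graft α β) : Prop where
  connected : G₀.graph.IsConnected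
  S_subset : S ⊆ G₀.T
  S_nonempty : S.Nonempty
  S_stable : G₀.graph.IsStable S
  ε_mem : ∀ s ∈ S, ε s ∈ G₀.graph.cut {s}
  disjoint_vertex : ∀ s ∈ S, Disjoint V(G₀.graph) V((H s).graph)
  disjoint_edge : ∀ s ∈ S, Disjoint E(G₀.graph) E((H s).graph)
  pairwise_disjoint_vertex : ∀ s ∈ S, ∀ t ∈ S, s ≠ t → Disjoint V((H s).graph) V((H t).graph)
  pairwise_disjoint_edge : ∀ s ∈ S, ∀ t ∈ S, s ≠ t → Disjoint E((H s).graph) E((H t).graph)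
  A_subset : ∀ s ∈ S, A s ⊆ V((H s).graph)
  ρ_mem : ∀ s ∈ S, ρ s ∈ A s
  vertexSet_eq : V(G.graph) = (V(G₀.graph) \ S) ∪ ⋃ s ∈ S, V((H s).graph)
  exists_attachment : ∃ f : α → β → α,
    (∀ s ∈ S, ∀ e ∈ G₀.graph.cut {s}, f s e ∈ A s) ∧
    (∀ s ∈ S, f s (ε s) = ρ s) ∧
    ∀ e u v, G.graph.IsLink e u v ↔
      (u ∉ S ∧ v ∉ S ∧ G₀.graph.IsLink e u v) ∨
      (∃ s ∈ S, (H s).graph.IsLink e u v) ∨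
      (∃ s ∈ S, u ∉ S ∧ G₀.graph.IsLink e u s ∧ v = f s e) ∨
      (∃ s ∈ S, v ∉ S ∧ G₀.graph.IsLink e v s ∧ u = f s e)
  T_eq : G.T = (G₀.T \ S) ∪ ⋃ s ∈ S, symmDiff (H s).T {ρ s}

/-- `MemP r A G` means `G ∈ P(r, A)`. -/
inductive MemP : α → Set α → Graft α β → Prop
  | base (r : α) (B : Set α) (G : Graft α β) (hG : MemR r B G) :
      MemP r (V(G.graph) \ B) G
  /-- A gluing sum over all of `B`, where the chosen edge at each `b ∈ B` joins `r` and `b`. -/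
  | glue (r : α) (B : Set α) (G : Graft α β) (ε : α → β)
      (H : α → Graft α β) (A : α → Set α) (ρ : α → α) (G' : Graft α β)
      (hG : MemR r B G)
      (hH : ∀ b ∈ B, MemP (ρ b) (A b) (H b))
      (hε : ∀ b ∈ B, G.graph.IsLink (ε b) r b)
      (hG' : IsGluingSum G B ε H A ρ G') :
      MemP r (V(G.graph) \ B) G'

/-- `G` is obtained from the disjoint grafts `G'` and `H` by adding a set of edges between
`A` and `V(H)`, the set `T` being that of `G'`; it is used for `H = (H, ∅)`. -/
structure IsJoining (G' : Graft α β) (A : Set α) (H G : Graft α β) : Prop where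
  left_le : G'.graph ≤ G.graph
  right_le : H.graph ≤ G.graph
  disjoint_vertex : Disjoint V(G'.graph) V(H.graph)
  vertexSet_eq : V(G.graph) = V(G'.graph) ∪ V(H.graph)
  edges_subset : E(G.graph) \ (E(G'.graph) ∪ E(H.graph)) ⊆ G.graph.edgesBetween A V(H.graph)
  T_eq : G.T = G'.T

end Graft

/-! ### Edge sets modulo two: boundaries, handshakes and conservative sets. -/

namespace Graph

variable {α β : Type*}

/-! From (ii) to (i), the induction needs a stronger statement, `HasRootedJoin`: there is a join
connected to `r` that is no larger than any edge set with the right parities outside `A`, whatever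
happens on `A`. In a rake, take one edge from `r` to each tooth; the teeth are stable, so their cuts
are disjoint, and each needs an edge. In a gluing sum, take these edges together with the joins of
the pieces. A competitor enters the piece at `b` only through `A b`, so inside it is at least as
large as the join of the piece, and a handshake shows that it also uses an edge at `b`. Extra
vertices joined only to `A` disturb parities only on `A`.

From (i) to (ii), give the edges of `F` length -1 and all other edges length +1. A minimum join is
conservative: no edge set with even degrees has negative length. Hence `F` is a forest, and, being
connected and covering `r`, a tree through `r`. Consider walks that follow the tree from `r` and
then leave `F` for good, with length never positive. The vertices reached in this way form
`reachSet`. Those reached with negative length through the tree edge `e₀` at `r` form `lowSet`, and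
those reached only with length 0 form `exactSet`.

The crucial point is `Graph.lowSet_separated`: a common vertex of two low sets, or an edge between
them, would close two walks of length at most -1 into an even edge set of negative length.
Contracting the low sets to single vertices therefore gives a rake with head `r`. Each low set is a
smaller instance of the same situation, rooted at the other end of `e₀`, and by
`Graph.IsReached.mem_exactSet_induce` the edges from `exactSet` enter it in its own `exactSet`.
Induction on the number of vertices gives membership in `MemP`. Edges leave `reachSet` only from
`exactSet`, so the unreached vertices form the additional graph `H`. -/

lemma mem_cut_singleton {G : Graph α β} {e : β} {v : α} :
    e ∈ G.cut {v} ↔ ∃ y, y ≠ v ∧ G.IsLink e v y := by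
  constructor
  · rintro ⟨x, rfl, y, hy, h⟩
    exact ⟨y, hy.2, h⟩
  · rintro ⟨y, hy, h⟩
    exact ⟨v, rfl, y, ⟨h.right_mem, hy⟩, h⟩

/-- The number of edges of `D` leaving each vertex, modulo two. -/
noncomputable def boundary (G : Graph α β) (D : Set β) : α → ZMod 2 :=
  fun v ↦ ((G.cut {v} ∩ D).ncard : ZMod 2)

lemma add_self_eq_zero_of_zmod_two (f : α → ZMod 2) : f + f = 0 := by
  funext v
  exact CharTwo.add_self_eq_zero (f v)

lemma boundary_empty (G : Graph α β) : G.boundary ∅ = 0 := by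
  funext v
  simp [boundary]

lemma natCast_ncard_symmDiff {X Y : Set β} (hX : X.Finite) (hY : Y.Finite) :
    ((symmDiff X Y).ncard : ZMod 2) = X.ncard + Y.ncard := by
  have h1 := Set.ncard_inter_add_ncard_sdiff_eq_ncard X Y hX
  have h2 := Set.ncard_inter_add_ncard_sdiff_eq_ncard Y X hY
  have h3 : (symmDiff X Y).ncard = (X \ Y).ncard + (Y \ X).ncard := by
    rw [Set.symmDiff_def]
    exact Set.ncard_union_eq (Set.disjoint_left.2 fun a h h' ↦ h.2 h'.1) hX.sdiff hY.sdiff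
  rw [Set.inter_comm] at h2
  rw [h3, ← h1, ← h2]
  push_cast
  have := CharTwo.add_self_eq_zero ((X ∩ Y).ncard : ZMod 2)
  linear_combination -this

lemma boundary_symmDiff (G : Graph α β) {D D' : Set β} (hD : D.Finite) (hD' : D'.Finite) :
    G.boundary (symmDiff D D') = G.boundary D + G.boundary D' := by
  funext v
  simp only [boundary, Pi.add_apply]
  rw [Set.inter_symmDiff_distrib_left]
  exact natCast_ncard_symmDiff (hD.inter_of_right _) (hD'.inter_of_right _)

open Classical in
lemma IsLink.boundary_singleton {G : Graph α β} {e : β} {x y : α} (h : G.IsLink e x y) :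
    G.boundary {e} = Pi.single x 1 + Pi.single y 1 := by
  funext v
  have hmem : e ∈ G.cut {v} ↔ x ≠ y ∧ (v = x ∨ v = y) := by
    rw [mem_cut_singleton]
    constructor
    · rintro ⟨z, hz, h'⟩
      rcases h'.eq_and_eq_or_eq_and_eq h with ⟨rfl, rfl⟩ | ⟨rfl, rfl⟩
      · exact ⟨hz.symm, .inl rfl⟩
      · exact ⟨hz, .inr rfl⟩
    · rintro ⟨hxy, rfl | rfl⟩
      · exact ⟨y, hxy.symm, h⟩
      · exact ⟨x, hxy, h.symm⟩
  simp only [boundary, Pi.add_apply, Pi.single_apply]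
  by_cases hv : e ∈ G.cut {v}
  · rw [Set.inter_eq_right.2 (Set.singleton_subset_iff.2 hv), Set.ncard_singleton]
    obtain ⟨hxy, rfl | rfl⟩ := hmem.1 hv
    · simp [hxy]
    · simp [hxy.symm]
  · rw [Set.inter_singleton_eq_empty.2 hv, Set.ncard_empty]
    rw [hmem] at hv
    by_cases hxy : x = y
    · subst hxy
      rw [CharTwo.add_self_eq_zero, Nat.cast_zero]
    · have : ¬ (v = x ∨ v = y) := fun h' ↦ hv ⟨hxy, h'⟩
      push Not at this
      simp [this.1, this.2]

/-- The handshake lemma on a set of vertices that no edge leaves. -/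
lemma sum_boundary_eq_zero {G : Graph α β} (s : Finset α)
    (hs : ∀ e x y, G.IsLink e x y → (x ∈ s ↔ y ∈ s)) {D : Set β} (hD : D.Finite)
    (hDE : D ⊆ E(G)) : ∑ v ∈ s, G.boundary D v = 0 := by
  classical
  induction D, hD using Set.Finite.induction_on with
  | empty => simp [boundary_empty]
  | @insert e D he hfin ih =>
    have hins : insert e D = symmDiff {e} D := by
      rw [Set.insert_eq, (Set.disjoint_singleton_left.2 he).symmDiff_eq_sup]
      rfl
    obtain ⟨x, y, h⟩ := G.exists_isLink_of_mem_edgeSet (hDE (Set.mem_insert e D))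
    rw [hins, boundary_symmDiff _ (Set.finite_singleton e) hfin, h.boundary_singleton]
    simp only [Pi.add_apply, Finset.sum_add_distrib,
      ih fun a ha ↦ hDE (Set.mem_insert_of_mem e ha), add_zero, Finset.sum_pi_single']
    have := hs e x y h
    by_cases hx : x ∈ s
    · simp only [hx, this.1 hx, if_true]
      decide
    · simp only [hx, mt this.2 hx, if_false, add_zero]

open Classical in
-- The sum of the boundary over `X` is `|T ∩ X|` modulo two, and the handshake lemma makes it
-- vanish. Thus an edge set with the prescribed parities certifies the component condition of a
-- graft.
lemma even_ncard_inter_of_boundary {G : Graph α β} {X T : Set α} (hX : X.Finite)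
    (hcl : ∀ e x y, G.IsLink e x y → (x ∈ X ↔ y ∈ X)) {D : Set β} (hD : D.Finite)
    (hDE : D ⊆ E(G)) (hT : ∀ v ∈ X, G.boundary D v = if v ∈ T then 1 else 0) :
    Even (T ∩ X).ncard := by
  have h := sum_boundary_eq_zero (G := G) hX.toFinset (by simpa using hcl) hD hDE
  rw [Finset.sum_congr rfl fun v hv ↦ hT v (by simpa using hv), Finset.sum_boole] at h
  rw [← ZMod.natCast_eq_zero_iff_even, ← h]
  congr 1
  rw [Set.ncard_eq_toFinset_card _ (hX.inter_of_right T)]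
  congr 1
  ext v
  simp [and_comm]

/-- `F` has at most half of the edges of every cycle, as every minimum join has. -/
def IsConservative (G : Graph α β) (F : Set β) : Prop :=
  ∀ C ⊆ E(G), G.boundary C = 0 → (C ∩ F).ncard ≤ (C \ F).ncard

lemma boundary_congr {G H : Graph α β} {D D' : Set β} {v : α}
    (h : ∀ e y, y ≠ v → ((G.IsLink e v y ∧ e ∈ D) ↔ (H.IsLink e v y ∧ e ∈ D'))) :
    G.boundary D v = H.boundary D' v := by
  unfold boundary
  congr 2
  ext e
  simp only [Set.mem_inter_iff, mem_cut_singleton]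
  constructor
  · rintro ⟨⟨y, hy, hl⟩, he⟩
    exact ⟨⟨y, hy, ((h e y hy).1 ⟨hl, he⟩).1⟩, ((h e y hy).1 ⟨hl, he⟩).2⟩
  · rintro ⟨⟨y, hy, hl⟩, he⟩
    exact ⟨⟨y, hy, ((h e y hy).2 ⟨hl, he⟩).1⟩, ((h e y hy).2 ⟨hl, he⟩).2⟩

lemma boundary_of_le {G H : Graph α β} (hle : H ≤ G) {D : Set β} (hD : D ⊆ E(H)) :
    H.boundary D = G.boundary D := by
  funext v
  refine boundary_congr fun e y _ ↦ ?_
  constructor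
  · rintro ⟨h, he⟩
    exact ⟨h.mono hle, he⟩
  · rintro ⟨h, he⟩
    exact ⟨(hle.isLink_iff (hD he)).2 h, he⟩

lemma IsConservative.of_le {G H : Graph α β} {F : Set β} (hF : G.IsConservative F) (hle : H ≤ G) :
    H.IsConservative (F ∩ E(H)) := by
  intro C hC h0
  have := hF C (hC.trans hle.edgeSet_mono) (by rw [← boundary_of_le hle hC, h0])
  have h1 : C ∩ (F ∩ E(H)) = C ∩ F := by
    ext e
    simpa using fun h _ ↦ hC h
  have h2 : C \ (F ∩ E(H)) = C \ F := by
    rw [← Set.sdiff_self_inter, h1, Set.sdiff_self_inter]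
  rwa [h1, h2]

end Graph

namespace Graft

variable {α β : Type*}

open Classical in
lemma isJoin_iff_boundary {G : Graft α β} {F : Set β} :
    G.IsJoin F ↔ F ⊆ E(G.graph) ∧
      ∀ v ∈ V(G.graph), G.graph.boundary F v = if v ∈ G.T then 1 else 0 := by
  unfold IsJoin Graph.boundary
  refine and_congr_right fun _ ↦ ⟨fun h v hv ↦ ?_, fun h ↦ ⟨fun v hv ↦ ?_, fun v hv ↦ ?_⟩⟩
  · split_ifs with hT
    · exact ZMod.natCast_eq_one_iff_odd.2 (h.1 v hT)
    · exact ZMod.natCast_eq_zero_iff_even.2 (h.2 v ⟨hv, hT⟩)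
  · exact ZMod.natCast_eq_one_iff_odd.1 (by rw [h v (G.T_subset hv), if_pos hv])
  · exact ZMod.natCast_eq_zero_iff_even.1 (by rw [h v hv.1, if_neg hv.2])

/-- `F Δ C` is again a join, and its size is `|F| - |C ∩ F| + |C \ F|`. -/
lemma IsMinimumJoin.isConservative {G : Graft α β} {F : Set β} (hF : G.IsMinimumJoin F) :
    G.graph.IsConservative F := by
  intro C hC h0
  obtain ⟨hJ, hmin⟩ := hF
  rw [isJoin_iff_boundary] at hJ
  have hFf := G.finite_edgeSet.subset hJ.1
  have hCf := G.finite_edgeSet.subset hC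
  have hle := hmin (symmDiff F C) (isJoin_iff_boundary.2 ⟨fun e he ↦ ?_, fun v hv ↦ ?_⟩)
  · have h1 := Set.ncard_inter_add_ncard_sdiff_eq_ncard F C hFf
    have h3 : (symmDiff F C).ncard = (F \ C).ncard + (C \ F).ncard := by
      rw [Set.symmDiff_def]
      exact Set.ncard_union_eq (Set.disjoint_left.2 fun a h h' ↦ h.2 h'.1) hFf.sdiff hCf.sdiff
    rw [Set.inter_comm] at h1
    omega
  · rcases he with he | he
    · exact hJ.1 he.1
    · exact hC he.1
  · rw [Graph.boundary_symmDiff _ hFf hCf, h0, add_zero, hJ.2 v hv]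

end Graft

/-! ### Counting by disjoint blocks, and rooted edge sets. -/

/-- Each `Y b` is charged to the part of `F'` in its own block `X b`. Only the blocks have to be
disjoint, and they need not cover `F'`. The blocks will be indexed by the teeth of a rake. -/
lemma Set.ncard_le_ncard_of_blocks {ι β : Type*} {B : Set ι} (hB : B.Finite) {X Y : ι → Set β}
    {F F' : Set β} (hF' : F'.Finite) (hY : ∀ b ∈ B, (Y b).Finite) (hF : F ⊆ ⋃ b ∈ B, Y b)
    (hX : ∀ b ∈ B, ∀ c ∈ B, b ≠ c → Disjoint (X b) (X c))
    (hXY : ∀ b ∈ B, (Y b).ncard ≤ (F' ∩ X b).ncard) : F.ncard ≤ F'.ncard := by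
  classical
  have key : ∀ s : Finset ι, (∀ b ∈ s, b ∈ B) →
      (⋃ b ∈ s, Y b).ncard ≤ (F' ∩ ⋃ b ∈ s, X b).ncard := by
    intro s
    induction s using Finset.induction_on with
    | empty => simp
    | @insert b s hb ih =>
      intro hs
      have hbB := hs b (Finset.mem_insert_self b s)
      have hsB : ∀ c ∈ s, c ∈ B := fun c hc ↦ hs c (Finset.mem_insert_of_mem hc)
      rw [Finset.set_biUnion_insert, Finset.set_biUnion_insert, Set.inter_union_distrib_left,
        Set.ncard_union_eq _ (hF'.inter_of_left _) (hF'.inter_of_left _)]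
      · exact (Set.ncard_union_le _ _).trans (Nat.add_le_add (hXY b hbB) (ih hsB))
      · refine Disjoint.mono Set.inter_subset_right Set.inter_subset_right ?_
        simp only [Set.disjoint_iUnion_right]
        intro c hc
        exact hX b hbB c (hsB c hc) fun h ↦ hb (h ▸ hc)
  have h := key hB.toFinset (by simp)
  simp only [Set.Finite.mem_toFinset] at h
  exact (Set.ncard_le_ncard hF (hB.biUnion hY)).trans
    (h.trans (Set.ncard_le_ncard Set.inter_subset_left hF'))

namespace Graph

variable {α β : Type*}

/-- Every end of an edge of `F` can be reached from `r` along edges of `F`. -/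
def IsRooted (G : Graph α β) (F : Set β) (r : α) : Prop :=
  ∀ e ∈ F, ∀ x, G.Inc e x → Relation.ReflTransGen (fun x y ↦ ∃ f ∈ F, G.IsLink f x y) r x

lemma IsRooted.isConnected {G : Graph α β} {F : Set β} {r : α} (h : G.IsRooted F r)
    (hFE : F ⊆ E(G)) (hF : F.Nonempty) : (G.determinedBy F).IsConnected ∧ G.Covers F r := by
  have hadj : ∀ x y, (G.determinedBy F).Adj x y ↔ ∃ f ∈ F, G.IsLink f x y := by
    intro x y
    constructor
    · rintro ⟨e, ⟨h1, h2⟩, -⟩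
      exact ⟨e, h1, h2⟩
    · rintro ⟨e, h1, h2⟩
      exact ⟨e, ⟨h1, h2⟩, ⟨e, h1, h2.inc_left⟩, ⟨e, h1, h2.inc_right⟩⟩
  have hreach : ∀ x, G.Covers F x → Relation.ReflTransGen (G.determinedBy F).Adj r x := by
    rintro x ⟨e, he, hx⟩
    exact Relation.ReflTransGen.mono (fun a b hab ↦ (hadj a b).2 hab) _ _ (h e he x hx)
  obtain ⟨e, he⟩ := hF
  obtain ⟨x, y, hl⟩ := G.exists_isLink_of_mem_edgeSet (hFE he)
  refine ⟨⟨⟨x, e, he, hl.inc_left⟩, fun u hu v hv ↦ ?_⟩, ?_⟩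
  · have hsymm : Relation.ReflTransGen (G.determinedBy F).Adj u r := by
      have := (hreach u hu).swap
      exact Relation.ReflTransGen.mono (fun a b hab ↦ Adj.symm hab) _ _ this
    exact hsymm.trans (hreach v hv)
  -- The walk from `r` to `x` either starts with an edge of `F` at `r` or is trivial, and then `e`
  -- itself covers `r`.
  · rcases (h e he x hl.inc_left).cases_head with h0 | ⟨z, ⟨f, hf, hfl⟩, -⟩
    · exact ⟨e, he, h0 ▸ hl.inc_left⟩
    · exact ⟨f, hf, hfl.inc_left⟩

lemma IsRooted.of_isConnected {G : Graph α β} {F : Set β} {r : α}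
    (h : (G.determinedBy F).IsConnected) (hr : G.Covers F r) : G.IsRooted F r := by
  intro e he x hx
  refine Relation.ReflTransGen.mono ?_ _ _ (h.2 r hr x ⟨e, he, hx⟩)
  rintro a b ⟨f, ⟨h1, h2⟩, -⟩
  exact ⟨f, h1, h2⟩

end Graph

/-! ### Structural properties of rakes. -/

namespace Graft

variable {α β : Type*}

/-- The shape of a rake, without its construction. -/
structure IsRake (r : α) (B : Set α) (G : Graft α β) : Prop where
  root_mem : r ∈ V(G.graph)
  root_notMem : r ∉ B
  subset : B ⊆ V(G.graph)
  stable : ∀ e x y, G.graph.IsLink e x y → x ∈ B → y ∉ B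
  adj_root : ∀ b ∈ B, G.graph.Adj r b
  exists_adj : ∀ x ∈ V(G.graph) \ B, x ≠ r → ∃ b ∈ B, G.graph.Adj x b
  mem_T_iff : ∀ v, v ≠ r → (v ∈ G.T ↔ v ∈ B)
  root_mem_T_iff : r ∈ G.T ↔ Odd B.ncard

/-- The star fixes `T` and the two enlargements never change it. A new edge has an end outside `B`,
so the teeth remain stable, and a new vertex arrives with a neighbour in `B`. -/
lemma MemR.isRake {r : α} {B : Set α} {G : Graft α β} (h : MemR r B G) : IsRake r B G := by
  induction h with
  | star G hr hV hE hadj heven hodd =>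
    have hrV : r ∈ V(G.graph) := by simp [hV]
    have hBV : B ⊆ V(G.graph) := by simp [hV]
    have hcard : V(G.graph).ncard = B.ncard + 1 := by
      rw [hV, Set.singleton_union, Set.ncard_insert_of_notMem hr (G.finite_vertexSet.subset hBV)]
    refine ⟨hrV, hr, hBV, fun e x y h hx hy ↦ ?_, hadj, fun x hx hxr ↦ ?_, fun v hv ↦ ?_, ?_⟩
    · have he := h.edge_mem
      rw [hE] at he
      obtain ⟨_, rfl, b, hb, hl⟩ := he
      rcases h.eq_and_eq_or_eq_and_eq hl with ⟨rfl, rfl⟩ | ⟨rfl, rfl⟩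
      · exact hr hx
      · exact hr hy
    · rw [hV] at hx
      exact (hx.1.elim hxr hx.2).elim
    · by_cases hev : Even V(G.graph).ncard
      · rw [heven hev, hV]
        simp [hv]
      · rw [hodd hev, hV]
        simp [hv]
    · by_cases hev : Even V(G.graph).ncard
      · rw [heven hev]
        rw [hcard, Nat.even_add_one, Nat.not_even_iff_odd] at hev
        simp [hrV, hev]
      · rw [hodd hev]
        rw [hcard, Nat.even_add_one, not_not] at hev
        simp [hev]
  | addVertex G G' x hG hx hle hV hne hE hT ih =>
    have hxB : x ∉ B := fun h ↦ hx (ih.subset h)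
    have hxr : x ≠ r := fun h ↦ hx (h ▸ ih.root_mem)
    refine ⟨hle.vertexSet_mono ih.root_mem, ih.root_notMem, ih.subset.trans hle.vertexSet_mono,
      fun e u v h hu hv ↦ ?_, fun b hb ↦ (ih.adj_root b hb).mono hle, fun v hv hvr ↦ ?_, ?_, ?_⟩
    · by_cases he : e ∈ E(G.graph)
      · exact ih.stable e u v ((hle.isLink_iff he).2 h) hu hv
      · obtain ⟨_, rfl, b, hb, hl⟩ := hE ⟨h.edge_mem, he⟩
        rcases h.eq_and_eq_or_eq_and_eq hl with ⟨rfl, rfl⟩ | ⟨rfl, rfl⟩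
        · exact hxB hu
        · exact hxB hv
    · rw [hV] at hv
      rcases hv with ⟨hv | rfl, hvB⟩
      · obtain ⟨b, hb, hadj⟩ := ih.exists_adj v ⟨hv, hvB⟩ hvr
        exact ⟨b, hb, hadj.mono hle⟩
      · obtain ⟨e, he⟩ := hne
        obtain ⟨_, rfl, b, hb, hl⟩ := hE he
        exact ⟨b, hb, hl.adj⟩
    · rw [hT]
      exact ih.mem_T_iff
    · rw [hT]
      exact ih.root_mem_T_iff
  | addEdges G G' hG hle hV hE hT ih =>
    refine ⟨hle.vertexSet_mono ih.root_mem, ih.root_notMem, ih.subset.trans hle.vertexSet_mono,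
      fun e u v h hu hv ↦ ?_, fun b hb ↦ (ih.adj_root b hb).mono hle, fun v hv hvr ↦ ?_, ?_, ?_⟩
    · by_cases he : e ∈ E(G.graph)
      · exact ih.stable e u v ((hle.isLink_iff he).2 h) hu hv
      · obtain ⟨x, hx, y, hy, hl⟩ := hE ⟨h.edge_mem, he⟩
        rcases h.eq_and_eq_or_eq_and_eq hl with ⟨rfl, rfl⟩ | ⟨rfl, rfl⟩
        · exact hx.2 hu
        · exact hy.2 hu
    · rw [hV] at hv
      obtain ⟨b, hb, hadj⟩ := ih.exists_adj v hv hvr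
      exact ⟨b, hb, hadj.mono hle⟩
    · rw [hT]
      exact ih.mem_T_iff
    · rw [hT]
      exact ih.root_mem_T_iff

end Graft

open Classical in
lemma Set.ite_mem_symmDiff_zmod_two {α : Type*} (s t : Set α) (v : α) :
    (if v ∈ symmDiff s t then 1 else 0 : ZMod 2) =
      (if v ∈ s then 1 else 0) + if v ∈ t then 1 else 0 := by
  by_cases hs : v ∈ s <;> by_cases ht : v ∈ t <;> simp [Set.mem_symmDiff, hs, ht]
  decide

/-! ### Rooted joins of rakes, gluing sums and joinings. -/

namespace Graft

variable {α β : Type*}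

open Classical in
/-- `G` has a join rooted at `r` that is smallest even among the edge sets for which the
parity is prescribed outside `A` only. -/
def HasRootedJoin (r : α) (A : Set α) (G : Graft α β) : Prop :=
  ∃ F ⊆ E(G.graph), (∀ v ∈ V(G.graph), G.graph.boundary F v = if v ∈ G.T then 1 else 0) ∧
    G.graph.IsRooted F r ∧
    ∀ F' ⊆ E(G.graph), (∀ v ∈ V(G.graph) \ A, G.graph.boundary F' v = if v ∈ G.T then 1 else 0) →
      F.ncard ≤ F'.ncard

lemma nonempty_cut_inter_of_boundary {G : Graph α β} {F : Set β} {v : α}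
    (h : G.boundary F v = 1) : (G.cut {v} ∩ F).Nonempty := by
  rw [Set.nonempty_iff_ne_empty]
  intro h0
  simp [Graph.boundary, h0] at h

/-- One edge from `r` to each tooth is optimal: every tooth is in `T`, so a competitor has an edge
in its cut, and by stability no edge lies in two of these cuts. -/
lemma IsRake.hasRootedJoin {r : α} {B : Set α} {G : Graft α β} (h : IsRake r B G) :
    HasRootedJoin r (V(G.graph) \ B) G := by
  classical
  have hBf := G.finite_vertexSet.subset h.subset
  rcases isEmpty_or_nonempty β with hβ | hβ
  -- Choosing an edge for every vertex requires a default edge. If there are no edges at all, there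
  -- are no teeth and the empty join works.
  · have hB : B = ∅ := Set.eq_empty_of_forall_notMem fun b hb ↦
      hβ.elim (h.adj_root b hb).choose
    refine ⟨∅, Set.empty_subset _, fun v hv ↦ ?_, fun e ↦ hβ.elim e, fun F' _ _ ↦ by simp⟩
    have hT : v ∉ G.T := by
      by_cases hvr : v = r
      · rw [hvr, h.root_mem_T_iff, hB]
        simp
      · rw [h.mem_T_iff v hvr, hB]
        exact Set.notMem_empty v
    simp [Graph.boundary_empty, hT]
  choose! ε hε using h.adj_root
  have hinj : Set.InjOn ε B := by
    intro b hb c hc hbc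
    have h1 := hε c hc
    rw [← hbc] at h1
    exact (hε b hb).right_unique h1
  have hsub : ε '' B ⊆ E(G.graph) := by
    rintro _ ⟨b, hb, rfl⟩
    exact (hε b hb).edge_mem
  refine ⟨ε '' B, hsub, fun v hv ↦ ?_, ?_, fun F' hF' hb ↦ ?_⟩
  · by_cases hvr : v = r
    · subst hvr
      have hcut : G.graph.cut {v} ∩ ε '' B = ε '' B := by
        rw [Set.inter_eq_right]
        rintro _ ⟨b, hb, rfl⟩
        exact Graph.mem_cut_singleton.2 ⟨b, fun hh ↦ h.root_notMem (hh ▸ hb), hε b hb⟩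
      rw [Graph.boundary, hcut, hinj.ncard_image]
      split_ifs with hT
      · exact ZMod.natCast_eq_one_iff_odd.2 (h.root_mem_T_iff.1 hT)
      · exact ZMod.natCast_eq_zero_iff_even.2 (Nat.not_odd_iff_even.1 (mt h.root_mem_T_iff.2 hT))
    · rw [h.mem_T_iff v hvr]
      split_ifs with hvB
      · have hcut : G.graph.cut {v} ∩ ε '' B = {ε v} := by
          ext e
          simp only [Set.mem_inter_iff, Graph.mem_cut_singleton, Set.mem_singleton_iff]
          constructor
          · rintro ⟨⟨y, hy, hl⟩, b, hb, rfl⟩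
            rcases hl.left_eq_or_eq (hε b hb) with rfl | rfl
            · exact (hvr rfl).elim
            · rfl
          · rintro rfl
            exact ⟨⟨r, fun hh ↦ hvr hh.symm, (hε v hvB).symm⟩, v, hvB, rfl⟩
        simp [Graph.boundary, hcut]
      · have hcut : G.graph.cut {v} ∩ ε '' B = ∅ := by
          ext e
          simp only [Set.mem_inter_iff, Graph.mem_cut_singleton, Set.mem_empty_iff_false, iff_false]
          rintro ⟨⟨y, hy, hl⟩, b, hb, rfl⟩
          rcases hl.left_eq_or_eq (hε b hb) with rfl | rfl
          · exact hvr rfl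
          · exact hvB hb
        simp [Graph.boundary, hcut]
  · rintro _ ⟨b, hb, rfl⟩ x hx
    rcases hx.eq_or_eq_of_isLink (hε b hb) with rfl | rfl
    · exact .refl
    · exact .single ⟨_, ⟨x, hb, rfl⟩, hε x hb⟩
  · refine Set.ncard_le_ncard_of_blocks hBf (X := fun b ↦ G.graph.cut {b}) (Y := fun b ↦ {ε b})
      (G.finite_edgeSet.subset hF') (fun _ _ ↦ Set.finite_singleton _) ?_ ?_ ?_
    · rintro _ ⟨b, hb, rfl⟩
      simp only [Set.mem_iUnion]
      exact ⟨b, hb, rfl⟩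
    · intro b hb c hc hbc
      rw [Set.disjoint_left]
      intro e he he'
      obtain ⟨y, -, hl⟩ := Graph.mem_cut_singleton.1 he
      obtain ⟨z, -, hl'⟩ := Graph.mem_cut_singleton.1 he'
      rcases hl'.left_eq_or_eq hl with rfl | rfl
      · exact hbc rfl
      · exact h.stable _ _ _ hl hb hc
    · intro b hbB
      rw [Set.ncard_singleton, Set.inter_comm, Nat.one_le_iff_ne_zero,
        ← Nat.pos_iff_ne_zero, Set.ncard_pos ((G.finite_edgeSet.subset hF').inter_of_right _)]
      refine nonempty_cut_inter_of_boundary ?_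
      rw [hb b ⟨h.subset hbB, fun hh ↦ hh.2 hbB⟩, if_pos]
      rw [h.mem_T_iff b fun hh ↦ h.root_notMem (hh ▸ hbB)]
      exact hbB

open Classical in
lemma sum_ite_mem_T_eq_zero (G : Graft α β) {F : Set β} (hF : F ⊆ E(G.graph))
    (hT : ∀ v ∈ V(G.graph), G.graph.boundary F v = if v ∈ G.T then 1 else 0) :
    ∑ v ∈ G.finite_vertexSet.toFinset, (if v ∈ G.T then (1 : ZMod 2) else 0) = 0 := by
  refine Eq.trans (Finset.sum_congr rfl fun v hv ↦ (hT v (by simpa using hv)).symm) ?_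
  exact Graph.sum_boundary_eq_zero (G := G.graph) G.finite_vertexSet.toFinset
    (fun e x y h ↦ by simp [h.left_mem, h.right_mem]) (G.finite_edgeSet.subset hF) hF

/-- The join consists of the edges `ε b` and the joins `F b` of the pieces. The block of `b` is the
cut of `b` in `G₀` together with the edges of `H b`; a competitor has at least `|F b|` edges in the
second part and at least one in the first. -/
lemma IsGluingSum.hasRootedJoin {r : α} {B : Set α} {G₀ : Graft α β} {ε : α → β}
    {H : α → Graft α β} {A : α → Set α} {ρ : α → α} {G : Graft α β} (hR : IsRake r B G₀)
    (hH : ∀ b ∈ B, HasRootedJoin (ρ b) (A b) (H b))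
    (hε : ∀ b ∈ B, G₀.graph.IsLink (ε b) r b) (hG : IsGluingSum G₀ B ε H A ρ G) :
    HasRootedJoin r (V(G₀.graph) \ B) G := by
  classical
  have hBf := G₀.finite_vertexSet.subset hR.subset
  have hinj : Set.InjOn ε B := by
    intro b hb c hc hbc
    have h1 := hε c hc
    rw [← hbc] at h1
    exact (hε b hb).right_unique h1
  obtain ⟨f, hfA, hfε, hlink⟩ := hG.exists_attachment
  choose! F hFE hFT hFr hFmin using hH
  have hrB := hR.root_notMem
  have hle : ∀ b ∈ B, (H b).graph ≤ G.graph := fun b hb ↦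
    ⟨fun v hv ↦ by
      rw [hG.vertexSet_eq]
      exact .inr (Set.mem_biUnion hb hv), fun e x y h ↦ (hlink e x y).2 (.inr (.inl ⟨b, hb, h⟩))⟩
  have hcut_mem : ∀ b ∈ B, ∀ x e, G₀.graph.IsLink e x b → e ∈ G₀.graph.cut {b} ∧ x ∉ B :=
    fun b hb x e h ↦ by
      have hxB : x ∉ B := fun hx ↦ hR.stable _ _ _ h hx hb
      exact ⟨Graph.mem_cut_singleton.2 ⟨x, fun hh ↦ hxB (hh ▸ hb), h.symm⟩, hxB⟩
  have hlε : ∀ b ∈ B, G.graph.IsLink (ε b) r (ρ b) := fun b hb ↦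
    (hlink _ _ _).2 (.inr (.inr (.inl ⟨b, hb, hrB, hε b hb, (hfε b hb).symm⟩)))
  have hVB : ∀ b ∈ B, ∀ v ∈ V((H b).graph), v ∉ V(G₀.graph) := fun b hb v hv hv0 ↦
    Set.disjoint_left.1 (hG.disjoint_vertex b hb) hv0 hv
  -- the links of `G` at a vertex of `H b`
  have hlH : ∀ b ∈ B, ∀ v ∈ V((H b).graph), ∀ e y, G.graph.IsLink e v y ↔
      (H b).graph.IsLink e v y ∨ (y ∉ B ∧ G₀.graph.IsLink e y b ∧ v = f b e) := by
    intro b hb v hv e y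
    rw [hlink]
    constructor
    · rintro (⟨-, -, h⟩ | ⟨c, hc, h⟩ | ⟨c, hc, -, h, -⟩ | ⟨c, hc, hyB, h, hvf⟩)
      · exact (hVB b hb v hv h.left_mem).elim
      · by_cases hbc : b = c
        · subst hbc
          exact .inl h
        · exact (Set.disjoint_left.1 (hG.pairwise_disjoint_vertex b hb c hc hbc) hv h.left_mem).elim
      · exact (hVB b hb v hv h.left_mem).elim
      · by_cases hbc : b = c
        · subst hbc
          exact .inr ⟨hyB, h, hvf⟩
        · have := hG.A_subset c hc (hfA c hc e (hcut_mem c hc y e h).1)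
          rw [← hvf] at this
          exact (Set.disjoint_left.1 (hG.pairwise_disjoint_vertex b hb c hc hbc) hv this).elim
    · rintro (h | ⟨h1, h2, h3⟩)
      · exact .inr (.inl ⟨b, hb, h⟩)
      · exact .inr (.inr (.inr ⟨b, hb, h1, h2, h3⟩))
  have hTH : ∀ b ∈ B, ∀ v ∈ V((H b).graph), v ∈ G.T ↔ v ∈ symmDiff (H b).T {ρ b} := by
    intro b hb v hv
    rw [hG.T_eq]
    constructor
    · rintro (h | h)
      · exact (hVB b hb v hv (G₀.T_subset h.1)).elim
      · simp only [Set.mem_iUnion] at h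
        obtain ⟨c, hc, h⟩ := h
        by_cases hbc : b = c
        · exact hbc ▸ h
        · have : v ∈ V((H c).graph) := by
            rcases h with h | h
            · exact (H c).T_subset h.1
            · exact (Set.mem_singleton_iff.1 h.1) ▸ hG.A_subset c hc (hG.ρ_mem c hc)
          exact (Set.disjoint_left.1 (hG.pairwise_disjoint_vertex b hb c hc hbc) hv this).elim
    · exact fun h ↦ .inr (Set.mem_biUnion hb h)
  have hedge0 : ∀ b ∈ B, ∀ e ∈ E((H b).graph), e ∉ E(G₀.graph) := fun b hb e he he0 ↦
    Set.disjoint_left.1 (hG.disjoint_edge b hb) he0 he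
  have hFedge : ∀ b ∈ B, ∀ c ∈ B, ∀ e ∈ F b, e ∈ E((H c).graph) → b = c := by
    intro b hb c hc e he hec
    by_contra hbc
    exact Set.disjoint_left.1 (hG.pairwise_disjoint_edge b hb c hc hbc) (hFE b hb he) hec
  set D : Set β := ⋃ b ∈ B, insert (ε b) (F b) with hD
  have hmemD : ∀ e, e ∈ D ↔ ∃ b ∈ B, e = ε b ∨ e ∈ F b := by simp [hD]
  have hεE : ∀ b ∈ B, ε b ∈ E(G₀.graph) := fun b hb ↦ (hε b hb).edge_mem
  have hDE : D ⊆ E(G.graph) := by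
    intro e he
    obtain ⟨b, hb, rfl | he⟩ := (hmemD e).1 he
    · exact (hlε b hb).edge_mem
    · exact (hle b hb).edgeSet_mono (hFE b hb he)
  have hρV : ∀ b ∈ B, ρ b ∈ V((H b).graph) := fun b hb ↦ hG.A_subset b hb (hG.ρ_mem b hb)
  have hHE : ∀ b ∈ B, (E((H b).graph)).Finite := fun b _ ↦ (H b).finite_edgeSet
  refine ⟨D, hDE, fun v hv ↦ ?_, ?_, fun F' hF' hpar ↦ ?_⟩
  · rw [hG.vertexSet_eq] at hv
    rcases hv with ⟨hv, hvB⟩ | hv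
    · have hvH : ∀ b ∈ B, v ∉ V((H b).graph) := fun b hb h ↦ hVB b hb v h hv
      have hTv : v ∈ G.T ↔ v ∈ G₀.T := by
        rw [hG.T_eq]
        constructor
        · rintro (h | h)
          · exact h.1
          · simp only [Set.mem_iUnion] at h
            obtain ⟨b, hb, h | h⟩ := h
            · exact (hvH b hb ((H b).T_subset h.1)).elim
            · exact (hvH b hb ((Set.mem_singleton_iff.1 h.1) ▸ hρV b hb)).elim
        · exact fun h ↦ .inl ⟨h, hvB⟩
      have hinc : ∀ e ∈ D, ∀ y, G.graph.IsLink e v y → v = r ∧ e ∈ ε '' B := by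
        intro e he y hl
        obtain ⟨b, hb, rfl | he⟩ := (hmemD e).1 he
        · rcases hl.left_eq_or_eq (hlε b hb) with h | h
          · exact ⟨h, b, hb, rfl⟩
          · exact (hvH b hb (h ▸ hρV b hb)).elim
        · exact (hvH b hb (((hle b hb).isLink_iff (hFE b hb he)).2 hl).left_mem).elim
      by_cases hvr : v = r
      · subst hvr
        have hcut : G.graph.cut {v} ∩ D = ε '' B := by
          ext e
          constructor
          · rintro ⟨h1, h2⟩
            obtain ⟨y, -, hl⟩ := Graph.mem_cut_singleton.1 h1
            exact (hinc e h2 y hl).2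
          · rintro ⟨b, hb, rfl⟩
            refine ⟨Graph.mem_cut_singleton.2 ⟨ρ b, fun h ↦ hvH b hb (h ▸ hρV b hb), hlε b hb⟩, ?_⟩
            exact (hmemD _).2 ⟨b, hb, .inl rfl⟩
        rw [Graph.boundary, hcut, hinj.ncard_image, hTv]
        split_ifs with hT
        · exact ZMod.natCast_eq_one_iff_odd.2 (hR.root_mem_T_iff.1 hT)
        · exact ZMod.natCast_eq_zero_iff_even.2
            (Nat.not_odd_iff_even.1 (mt hR.root_mem_T_iff.2 hT))
      · have hcut : G.graph.cut {v} ∩ D = ∅ := by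
          ext e
          simp only [Set.mem_inter_iff, Set.mem_empty_iff_false, iff_false]
          rintro ⟨h1, h2⟩
          obtain ⟨y, -, hl⟩ := Graph.mem_cut_singleton.1 h1
          exact hvr (hinc e h2 y hl).1
        rw [hTv, hR.mem_T_iff v hvr, if_neg hvB]
        simp [Graph.boundary, hcut]
    · simp only [Set.mem_iUnion] at hv
      obtain ⟨b, hb, hv⟩ := hv
      have hrv : r ≠ v := fun h ↦ hVB b hb v hv (h ▸ hR.root_mem)
      -- At a vertex of `H b` only `ε b` and `F b` contribute to `D`. The edge `ε b` changes the
      -- parity at `ρ b`, which accounts for `{ρ b}` in the symmetric difference defining `T`.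
      have h1 : G.graph.boundary D v = G.graph.boundary (symmDiff {ε b} (F b)) v := by
        have hsd : symmDiff {ε b} (F b) = insert (ε b) (F b) := by
          rw [Set.insert_eq, (Set.disjoint_singleton_left.2 fun h ↦
            hedge0 b hb _ (hFE b hb h) (hεE b hb)).symmDiff_eq_sup]
          rfl
        rw [hsd]
        refine Graph.boundary_congr fun e y _ ↦ and_congr_right fun hl ↦ ?_
        rw [hmemD, Set.mem_insert_iff]
        refine ⟨?_, fun h ↦ ⟨b, hb, h⟩⟩
        rintro ⟨c, hc, h⟩
        have hcb : c = b := by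
          by_contra hcb
          have hvc : v ∈ V((H c).graph) := by
            rcases h with rfl | h
            · rcases hl.left_eq_or_eq (hlε c hc) with h | h
              · exact (hrv h.symm).elim
              · exact h ▸ hρV c hc
            · exact (((hle c hc).isLink_iff (hFE c hc h)).2 hl).left_mem
          exact Set.disjoint_left.1 (hG.pairwise_disjoint_vertex c hc b hb hcb) hvc hv
        exact hcb ▸ h
      rw [h1, Graph.boundary_symmDiff _ (Set.finite_singleton _) ((hHE b hb).subset (hFE b hb)),
        (hlε b hb).boundary_singleton, ← Graph.boundary_of_le (hle b hb) (hFE b hb)]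
      simp only [Pi.add_apply, hFT b hb v hv, Pi.single_apply, if_neg hrv.symm, zero_add,
        hTH b hb v hv, Set.ite_mem_symmDiff_zmod_two, Set.mem_singleton_iff]
      exact add_comm _ _
  · intro e he x hx
    obtain ⟨b, hb, he⟩ := (hmemD e).1 he
    have hstep : Relation.ReflTransGen (fun x y ↦ ∃ f ∈ D, G.graph.IsLink f x y) r (ρ b) :=
      .single ⟨ε b, (hmemD _).2 ⟨b, hb, .inl rfl⟩, hlε b hb⟩
    rcases he with rfl | he
    · rcases hx.eq_or_eq_of_isLink (hlε b hb) with rfl | rfl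
      · exact .refl
      · exact hstep
    · refine hstep.trans ?_
      refine Relation.ReflTransGen.mono ?_ _ _
        (hFr b hb e he x (((hle b hb).inc_congr (hFE b hb he)).2 hx))
      rintro u v ⟨g, hg, hgl⟩
      exact ⟨g, (hmemD _).2 ⟨b, hb, .inr hg⟩, hgl.mono (hle b hb)⟩
  · have hF'f := G.finite_edgeSet.subset hF'
    refine Set.ncard_le_ncard_of_blocks hBf (X := fun b ↦ G₀.graph.cut {b} ∪ E((H b).graph))
      (Y := fun b ↦ insert (ε b) (F b)) hF'f
      (fun b hb ↦ ((hHE b hb).subset (hFE b hb)).insert _) subset_rfl ?_ ?_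
    · intro b hb c hc hbc
      rw [Set.disjoint_left]
      have hcutE : ∀ b, ∀ e ∈ G₀.graph.cut {b}, e ∈ E(G₀.graph) := fun b e he ↦ by
        obtain ⟨y, -, hl⟩ := Graph.mem_cut_singleton.1 he
        exact hl.edge_mem
      rintro e (he | he) (he' | he')
      · obtain ⟨y, -, hl⟩ := Graph.mem_cut_singleton.1 he
        obtain ⟨z, -, hl'⟩ := Graph.mem_cut_singleton.1 he'
        rcases hl'.left_eq_or_eq hl with rfl | rfl
        · exact hbc rfl
        · exact hR.stable _ _ _ hl hb hc
      · exact hedge0 c hc e he' (hcutE b e he)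
      · exact hedge0 b hb e he (hcutE c e he')
      · exact Set.disjoint_left.1 (hG.pairwise_disjoint_edge b hb c hc hbc) he he'
    · intro b hb
      have hsplit : F' ∩ (G₀.graph.cut {b} ∪ E((H b).graph)) =
          (F' ∩ G₀.graph.cut {b}) ∪ (F' ∩ E((H b).graph)) := Set.inter_union_distrib_left ..
      rw [hsplit, Set.ncard_union_eq _ (hF'f.inter_of_left _) (hF'f.inter_of_left _)]
      swap
      · rw [Set.disjoint_left]
        rintro e ⟨-, he⟩ ⟨-, he'⟩
        obtain ⟨y, -, hl⟩ := Graph.mem_cut_singleton.1 he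
        exact hedge0 b hb e he' hl.edge_mem
      have hparH : ∀ v ∈ V((H b).graph), G.graph.boundary F' v =
          if v ∈ symmDiff (H b).T {ρ b} then 1 else 0 := fun v hv ↦ by
        rw [hpar v ⟨(hle b hb).vertexSet_mono hv, fun h ↦ hVB b hb v hv h.1⟩]
        simp only [hTH b hb v hv]
      -- Edges entering `H b` from outside end in `A b`, and so does the change at `ρ b ∈ A b`.
      -- Outside `A b` the competitor has the parities of `H b`, which is all that the minimality of
      -- `F b` requires.
      have hin : (F b).ncard ≤ (F' ∩ E((H b).graph)).ncard := by
        refine hFmin b hb _ Set.inter_subset_right fun v hv ↦ ?_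
        have h1 : (H b).graph.boundary (F' ∩ E((H b).graph)) v = G.graph.boundary F' v := by
          refine Graph.boundary_congr fun e y _ ↦ ?_
          rw [hlH b hb v hv.1]
          constructor
          · rintro ⟨h1, h2⟩
            exact ⟨.inl h1, h2.1⟩
          · rintro ⟨h1 | ⟨-, h1, rfl⟩, h2⟩
            · exact ⟨h1, h2, h1.edge_mem⟩
            · exact (hv.2 (hfA b hb e (hcut_mem b hb y e h1).1)).elim
        rw [h1, hparH v hv.1]
        have hvρ : v ≠ ρ b := fun h ↦ hv.2 (h ▸ hG.ρ_mem b hb)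
        simp [Set.mem_symmDiff, hvρ]
      -- Without an edge in this cut, the edges of `F'` inside `H b` would have odd degree exactly
      -- at the vertices of `(H b).T Δ {ρ b}`, an odd set, against the handshake lemma.
      have hout : (F' ∩ G₀.graph.cut {b}).Nonempty := by
        rw [Set.nonempty_iff_ne_empty]
        intro h0
        have h1 : ∀ v ∈ V((H b).graph),
            (H b).graph.boundary (F' ∩ E((H b).graph)) v = G.graph.boundary F' v := by
          intro v hv
          refine Graph.boundary_congr fun e y _ ↦ ?_
          rw [hlH b hb v hv]
          constructor
          · rintro ⟨h1, h2⟩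
            exact ⟨.inl h1, h2.1⟩
          · rintro ⟨h1 | ⟨-, h1, rfl⟩, h2⟩
            · exact ⟨h1, h2, h1.edge_mem⟩
            · have : e ∈ F' ∩ G₀.graph.cut {b} := ⟨h2, (hcut_mem b hb y e h1).1⟩
              rw [h0] at this
              exact this.elim
        have h2 := Graph.sum_boundary_eq_zero (G := (H b).graph) (H b).finite_vertexSet.toFinset
          (fun e x y h ↦ by simp [h.left_mem, h.right_mem]) (hF'f.inter_of_left _)
          (Set.inter_subset_right : F' ∩ E((H b).graph) ⊆ _)
        have h3 := sum_ite_mem_T_eq_zero (H b) (hFE b hb) (hFT b hb)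
        have h4 : ∀ v ∈ (H b).finite_vertexSet.toFinset,
            (H b).graph.boundary (F' ∩ E((H b).graph)) v =
              (if v ∈ (H b).T then 1 else 0) + if v = ρ b then 1 else 0 := by
          intro v hv
          rw [Set.Finite.mem_toFinset] at hv
          rw [h1 v hv, hparH v hv, Set.ite_mem_symmDiff_zmod_two]
          simp only [Set.mem_singleton_iff]
        rw [Finset.sum_congr rfl h4, Finset.sum_add_distrib, h3] at h2
        simp [hρV b hb] at h2
      have h1 := (Set.ncard_pos (hF'f.inter_of_left _)).2 hout
      have h2 := Set.ncard_insert_le (ε b) (F b)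
      omega

lemma MemP.hasRootedJoin {r : α} {A : Set α} {G : Graft α β} (h : MemP r A G) :
    HasRootedJoin r A G := by
  induction h with
  | base r B G hG => exact hG.isRake.hasRootedJoin
  | glue r B G ε H A ρ G' hG hH hε hG' ih => exact hG'.hasRootedJoin hG.isRake ih hε

/-- The join of `G'` remains a join of `G`. For any join of `G`, its part in `G'` can have wrong
parities only on `A`, where the new edges attach, so it is at least as large. -/
lemma IsJoining.exists_connected_minimumJoin {r : α} {A : Set α} {G G' H : Graft α β}
    (hP : HasRootedJoin r A G') (hJ : IsJoining G' A H G)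
    (hT : G.T.Nonempty) :
    ∃ F : Set β, G.IsConnectedMinimumJoin F ∧ G.graph.Covers F r := by
  classical
  obtain ⟨F, hFE, hFT, hFr, hFmin⟩ := hP
  have hl : ∀ v ∈ V(G'.graph), ∀ e y, G.graph.IsLink e v y → e ∉ E(G'.graph) → v ∈ A := by
    intro v hv e y hl he
    have heH : e ∉ E(H.graph) := fun h ↦ Set.disjoint_left.1 hJ.disjoint_vertex hv
      ((hJ.right_le.isLink_iff h).2 hl).left_mem
    obtain ⟨a, ha, w, hw, hl'⟩ := hJ.edges_subset ⟨hl.edge_mem, fun h ↦ h.elim he heH⟩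
    rcases hl.left_eq_or_eq hl' with rfl | rfl
    · exact ha
    · exact (Set.disjoint_left.1 hJ.disjoint_vertex hv hw).elim
  have hFG : F ⊆ E(G.graph) := hFE.trans hJ.left_le.edgeSet_mono
  have hroot : G.graph.IsRooted F r := by
    intro e he x hx
    refine Relation.ReflTransGen.mono ?_ _ _ (hFr e he x ((hJ.left_le.inc_congr (hFE he)).2 hx))
    rintro u v ⟨g, hg, hgl⟩
    exact ⟨g, hg, hgl.mono hJ.left_le⟩
  have hne : F.Nonempty := by
    obtain ⟨t, ht⟩ := hT
    rw [hJ.T_eq] at ht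
    obtain ⟨e, -, he⟩ := nonempty_cut_inter_of_boundary (G := G'.graph) (F := F) (v := t)
      (by rw [hFT t (G'.T_subset ht), if_pos ht])
    exact ⟨e, he⟩
  have hjoin : G.IsJoin F := by
    rw [isJoin_iff_boundary]
    refine ⟨hFG, fun v hv ↦ ?_⟩
    rw [← Graph.boundary_of_le hJ.left_le hFE, hJ.T_eq]
    by_cases hv' : v ∈ V(G'.graph)
    · exact hFT v hv'
    · rw [if_neg fun h ↦ hv' (G'.T_subset h), Graph.boundary]
      have : G'.graph.cut {v} ∩ F = ∅ := by
        ext e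
        simp only [Set.mem_inter_iff, Graph.mem_cut_singleton, Set.mem_empty_iff_false, iff_false]
        rintro ⟨⟨y, -, h⟩, -⟩
        exact hv' h.left_mem
      simp [this]
  obtain ⟨hc, hcov⟩ := hroot.isConnected hFG hne
  refine ⟨F, ⟨⟨hjoin, fun F' hF' ↦ ?_⟩, hne, hc⟩, hcov⟩
  rw [isJoin_iff_boundary] at hF'
  refine (hFmin (F' ∩ E(G'.graph)) Set.inter_subset_right fun v hv ↦ ?_).trans
    (Set.ncard_le_ncard Set.inter_subset_left (G.finite_edgeSet.subset hF'.1))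
  rw [← hJ.T_eq, ← hF'.2 v (hJ.left_le.vertexSet_mono hv.1)]
  refine Graph.boundary_congr fun e y _ ↦ ?_
  constructor
  · rintro ⟨h1, h2⟩
    exact ⟨h1.mono hJ.left_le, h2.1⟩
  · rintro ⟨h1, h2⟩
    have he : e ∈ E(G'.graph) := by
      by_contra he
      exact hv.2 (hl v hv.1 e y h1 he)
    exact ⟨(hJ.left_le.isLink_iff he).2 h1, h2, he⟩

end Graft

/-! ### Building a rake from its structural properties. -/

namespace Graph

variable {α β : Type*}

lemma isConnected_of_adj {G : Graph α β} {r : α} {B : Set α} (hr : r ∈ V(G))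
    (hadj : ∀ b ∈ B, G.Adj r b) (hex : ∀ x ∈ V(G) \ B, x ≠ r → ∃ b ∈ B, G.Adj x b) :
    G.IsConnected := by
  have h : ∀ x ∈ V(G), Relation.ReflTransGen G.Adj r x := by
    intro x hx
    by_cases hxr : x = r
    · rw [hxr]
    by_cases hxB : x ∈ B
    · exact .single (hadj x hxB)
    · obtain ⟨b, hb, hxb⟩ := hex x ⟨hx, hxB⟩ hxr
      exact .tail (.single (hadj b hb)) hxb.symm
  refine ⟨⟨r, hr⟩, fun x hx y hy ↦ ?_⟩
  exact (Relation.ReflTransGen.mono (fun a b hab ↦ Adj.symm hab) _ _ (h x hx).swap).trans (h y hy)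

lemma IsConnected.even_component {G : Graph α β} (h : G.IsConnected) {T : Set α} (hT : T ⊆ V(G))
    (hev : Even T.ncard) : ∀ x ∈ V(G), Even (T ∩ G.componentOf x).ncard := by
  intro x hx
  have : T ∩ G.componentOf x = T :=
    Set.inter_eq_left.2 fun t ht ↦ ⟨hT ht, h.2 x hx t (hT ht)⟩
  rwa [this]

end Graph

namespace Graft

variable {α β : Type*}

lemma even_ncard_of_mem_iff {r : α} {B T : Set α} (hB : B.Finite) (hr : r ∉ B)
    (hT : ∀ v, v ≠ r → (v ∈ T ↔ v ∈ B)) (hrT : r ∈ T ↔ Odd B.ncard) : Even T.ncard := by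
  by_cases h : Odd B.ncard
  · have : T = insert r B := by
      ext v
      by_cases hv : v = r
      · simp [hv, hrT, h]
      · simp [hv, hT v hv]
    rw [this, Set.ncard_insert_of_notMem hr hB]
    exact h.add_one
  · have : T = B := by
      ext v
      by_cases hv : v = r
      · simp [hv, hrT, h, hr]
      · simp [hT v hv]
    rw [this]
    exact Nat.not_odd_iff_even.1 h

/-- The part of a rake that consists of the teeth, the vertices in `X`, and the edges between. -/
def rakePart (G : Graph α β) (B X : Set α) : Graph α β :=
  (G.restrict (G.edgesBetween X B)).induce (X ∪ B)

lemma rakePart_le {G : Graph α β} {B X : Set α} (hB : B ⊆ V(G)) (hX : X ⊆ V(G)) :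
    rakePart G B X ≤ G :=
  ⟨Set.union_subset hX hB, fun _ _ _ h ↦ h.1.2⟩

lemma edgeSet_rakePart (G : Graph α β) (B X : Set α) :
    E(rakePart G B X) = G.edgesBetween X B := by
  ext e
  constructor
  · rintro ⟨x, y, ⟨h, -⟩, -⟩
    exact h
  · rintro ⟨x, hx, y, hy, h⟩
    exact ⟨x, y, ⟨⟨x, hx, y, hy, h⟩, h⟩, .inl hx, .inr hy⟩

lemma isLink_rakePart {G : Graph α β} {B X : Set α} {e : β} {x b : α} (hx : x ∈ X) (hb : b ∈ B)
    (h : G.IsLink e x b) : (rakePart G B X).IsLink e x b :=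
  ⟨⟨⟨x, hx, b, hb, h⟩, h⟩, .inl hx, .inr hb⟩

/-- The part of a rake that consists of the teeth, the vertices in `X`, and the edges between,
as a graft. -/
def IsRake.part {r : α} {B : Set α} {G : Graft α β} (h : IsRake r B G) (X : Set α)
    (hX : X ⊆ V(G.graph) \ B) (hr : r ∈ X) : Graft α β where
  graph := rakePart G.graph B X
  T := G.T
  finite_vertexSet := G.finite_vertexSet.subset
    (rakePart_le h.subset (hX.trans Set.sdiff_subset)).vertexSet_mono
  finite_edgeSet := G.finite_edgeSet.subset
    (rakePart_le h.subset (hX.trans Set.sdiff_subset)).edgeSet_mono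
  T_subset v hv := by
    by_cases hvr : v = r
    · exact .inl (hvr ▸ hr)
    · exact .inr ((h.mem_T_iff v hvr).1 hv)
  even_component := by
    refine Graph.IsConnected.even_component
      (Graph.isConnected_of_adj (G := rakePart G.graph B X) (r := r) (B := B) (.inl hr) (fun b hb ↦ ?_) (fun x hx hxr ↦ ?_))
      (fun v hv ↦ ?_) (even_ncard_of_mem_iff (G.finite_vertexSet.subset h.subset) h.root_notMem
        h.mem_T_iff h.root_mem_T_iff)
    · obtain ⟨e, he⟩ := h.adj_root b hb
      exact ⟨e, isLink_rakePart hr hb he⟩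
    · have hxX : x ∈ X := hx.1.resolve_right hx.2
      obtain ⟨b, hb, e, he⟩ := h.exists_adj x (hX hxX) hxr
      exact ⟨b, hb, e, isLink_rakePart hxX hb he⟩
    · by_cases hvr : v = r
      · exact .inl (hvr ▸ hr)
      · exact .inr ((h.mem_T_iff v hvr).1 hv)

/-- Starting from the star at `r`, the vertices of `X` are added one at a time, each with all its
edges to `B`; there is at least one by `exists_adj`. -/
lemma IsRake.memR_part {r : α} {B : Set α} {G : Graft α β} (h : IsRake r B G) {X : Set α}
    (hXf : X.Finite) (hX : insert r X ⊆ V(G.graph) \ B) :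
    MemR r B (h.part (insert r X) hX (Set.mem_insert r X)) := by
  have hBf := G.finite_vertexSet.subset h.subset
  induction X, hXf using Set.Finite.induction_on with
  | empty =>
    have hcard : ({r} ∪ B : Set α).ncard = B.ncard + 1 := by
      rw [Set.singleton_union, Set.ncard_insert_of_notMem h.root_notMem hBf]
    have hV : V((h.part (insert r ∅) hX (Set.mem_insert r ∅)).graph) = {r} ∪ B := by
      change insert r ∅ ∪ B = _
      simp
    refine .star _ h.root_notMem hV ?_ ?_ ?_ ?_
    · refine (edgeSet_rakePart _ _ _).trans ?_
      ext e
      constructor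
      · rintro ⟨x, hx, b, hb, hl⟩
        exact ⟨x, by simpa using hx, b, hb, isLink_rakePart hx hb hl⟩
      · rintro ⟨x, hx, b, hb, hl⟩
        exact ⟨x, by simpa using hx, b, hb, hl.1.2⟩
    · intro b hb
      obtain ⟨e, he⟩ := h.adj_root b hb
      exact ⟨e, isLink_rakePart (Set.mem_insert r ∅) hb he⟩
    · intro hev
      rw [hV, hcard, Nat.even_add_one, Nat.not_even_iff_odd] at hev
      rw [hV]
      change G.T = _
      ext v
      by_cases hv : v = r
      · subst hv
        simpa using h.root_mem_T_iff.2 hev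
      · simpa [hv] using h.mem_T_iff v hv
    · intro hev
      rw [hV, hcard, Nat.even_add_one, not_not] at hev
      rw [hV]
      change G.T = _
      ext v
      by_cases hv : v = r
      · subst hv
        simpa using mt h.root_mem_T_iff.1 (Nat.not_odd_iff_even.2 hev)
      · simpa [hv] using h.mem_T_iff v hv
  | @insert x X hx hXf ih =>
    have hX' : insert r X ⊆ V(G.graph) \ B :=
      (Set.insert_subset_insert (Set.subset_insert x X)).trans hX
    have hxV := hX (Set.mem_insert_of_mem r (Set.mem_insert x X))
    by_cases hxr : x = r
    · subst hxr
      simp only [Set.insert_idem]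
      exact ih hX'
    have hxX : x ∉ insert r X := fun hh ↦ hh.elim hxr hx
    have hmem : ∀ e, e ∈ E(rakePart G.graph B (insert r (insert x X))) \
        E(rakePart G.graph B (insert r X)) ↔ ∃ b ∈ B, G.graph.IsLink e x b := by
      intro e
      rw [edgeSet_rakePart, edgeSet_rakePart]
      constructor
      · rintro ⟨⟨y, hy, b, hb, hl⟩, he⟩
        rcases hy with rfl | rfl | hy
        · exact (he ⟨y, .inl rfl, b, hb, hl⟩).elim
        · exact ⟨b, hb, hl⟩
        · exact (he ⟨y, .inr hy, b, hb, hl⟩).elim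
      · rintro ⟨b, hb, hl⟩
        refine ⟨⟨x, .inr (.inl rfl), b, hb, hl⟩, ?_⟩
        rintro ⟨y, hy, c, hc, hl'⟩
        rcases hl.left_eq_or_eq hl' with rfl | rfl
        · exact hxX hy
        · exact hxV.2 hc
    refine .addVertex _ _ x (ih hX') ?_ ⟨?_, ?_⟩ ?_ ?_ ?_ rfl
    · rintro (hh | hh)
      · exact hxX hh
      · exact hxV.2 hh
    · change insert r X ∪ B ⊆ insert r (insert x X) ∪ B
      exact Set.union_subset_union_left _ (Set.insert_subset_insert (Set.subset_insert x X))
    · rintro e u v ⟨⟨⟨y, hy, b, hb, hl⟩, hl'⟩, hu, hv⟩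
      have hsub : insert r X ⊆ insert r (insert x X) :=
        Set.insert_subset_insert (Set.subset_insert x X)
      exact ⟨⟨⟨y, hsub hy, b, hb, hl⟩, hl'⟩, hu.imp (@hsub u) id, hv.imp (@hsub v) id⟩
    · change insert r (insert x X) ∪ B = (insert r X ∪ B) ∪ {x}
      ext v
      simp only [Set.mem_union, Set.mem_insert_iff, Set.mem_singleton_iff]
      tauto
    · obtain ⟨b, hb, e, he⟩ := h.exists_adj x hxV hxr
      exact ⟨e, (hmem e).2 ⟨b, hb, he⟩⟩
    · intro e he
      obtain ⟨b, hb, hl⟩ := (hmem e).1 he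
      exact ⟨x, rfl, b, hb, isLink_rakePart (.inr (.inl rfl)) hb hl⟩

/-- Since `B` is stable, an edge missing from the part on all vertices avoids `B` at both ends, so a
single use of the last rule restores all of them. -/
lemma IsRake.memR {r : α} {B : Set α} {G : Graft α β} (h : IsRake r B G) : MemR r B G := by
  have hrV : r ∈ V(G.graph) \ B := ⟨h.root_mem, h.root_notMem⟩
  have hX : insert r (V(G.graph) \ B) ⊆ V(G.graph) \ B := Set.insert_subset hrV subset_rfl
  have hV : insert r (V(G.graph) \ B) ∪ B = V(G.graph) := by
    rw [Set.insert_eq_of_mem hrV, Set.sdiff_union_of_subset h.subset]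
  refine .addEdges _ G (h.memR_part (G.finite_vertexSet.subset Set.sdiff_subset) hX)
    (rakePart_le h.subset (hX.trans Set.sdiff_subset)) hV.symm ?_ rfl
  rintro e ⟨he, he'⟩
  have he'' : e ∉ G.graph.edgesBetween (insert r (V(G.graph) \ B)) B := by
    rwa [← edgeSet_rakePart]
  obtain ⟨x, y, hl⟩ := G.graph.exists_isLink_of_mem_edgeSet he
  change e ∈ G.graph.edgesBetween ((insert r (V(G.graph) \ B) ∪ B) \ B)
    ((insert r (V(G.graph) \ B) ∪ B) \ B)
  rw [hV]
  have hxB : x ∉ B := fun hx ↦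
    he'' ⟨y, .inr ⟨hl.right_mem, h.stable _ _ _ hl hx⟩, x, hx, hl.symm⟩
  have hyB : y ∉ B := fun hy ↦ he'' ⟨x, .inr ⟨hl.left_mem, hxB⟩, y, hy, hl⟩
  exact ⟨x, ⟨hl.left_mem, hxB⟩, y, ⟨hl.right_mem, hyB⟩, hl⟩

end Graft

/-! ### Walks of nonpositive length and the low sets. -/

namespace Graph

variable {α β : Type*}

/-- `G.TreeWalk F r x Q`: some walk along edges of `F` from `r` to `x` uses exactly the edges in `Q`
an odd number of times. -/
inductive TreeWalk (G : Graph α β) (F : Set β) (r : α) : α → Set β → Prop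
  | refl : TreeWalk G F r r ∅
  | step {x y : α} {e : β} {Q : Set β} (h : TreeWalk G F r x Q) (he : e ∈ F)
      (hl : G.IsLink e x y) : TreeWalk G F r y (symmDiff Q {e})

/-- As `Graph.TreeWalk`, for walks whose first edge is `e₀` and which never return to `r`. -/
inductive Branch (G : Graph α β) (F : Set β) (r : α) (e₀ : β) : α → Set β → Prop
  | start {c : α} (he : e₀ ∈ F) (hl : G.IsLink e₀ r c) (hc : c ≠ r) : Branch G F r e₀ c {e₀}
  | step {x y : α} {e : β} {Q : Set β} (h : Branch G F r e₀ x Q) (he : e ∈ F)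
      (hl : G.IsLink e x y) (hy : y ≠ r) : Branch G F r e₀ y (symmDiff Q {e})

/-- A walk described by `P` continued by a walk outside `F`, where each step outside `F`
lowers the counter by one. -/
inductive Climb (G : Graph α β) (F : Set β) (P : α → Set β → Prop) : ℕ → α → Set β → Prop
  | start {z : α} {Q : Set β} (h : P z Q) : Climb G F P Q.ncard z Q
  | step {k : ℕ} {u v : α} {e : β} {D : Set β} (h : Climb G F P (k + 1) u D) (he : e ∉ F)
      (hl : G.IsLink e u v) : Climb G F P k v (symmDiff D {e})

/-- The vertices that can be reached through `e₀` by a walk of negative length. -/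
def lowSet (G : Graph α β) (F : Set β) (r : α) (e₀ : β) : Set α :=
  {v | ∃ k D, G.Climb F (G.Branch F r e₀) (k + 1) v D}

variable {G : Graph α β} {F : Set β} {r x y u v : α} {e₀ e₁ : β} {Q Q' D : Set β} {k : ℕ}

/-- `F` is a forest: all edges of `C` are in `F`, but at most half of them may be. -/
lemma IsConservative.eq_empty (hc : G.IsConservative F) (hE : E(G).Finite) (hF : F ⊆ E(G))
    {C : Set β} (hC : C ⊆ F) (h0 : G.boundary C = 0) : C = ∅ := by
  have h := hc C (hC.trans hF) h0
  rw [Set.inter_eq_left.2 hC, Set.sdiff_eq_empty.2 hC, Set.ncard_empty] at h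
  exact (Set.ncard_eq_zero (hE.subset (hC.trans hF))).1 (Nat.le_zero.1 h)

lemma TreeWalk.subset (h : G.TreeWalk F r x Q) : Q ⊆ F := by
  induction h with
  | refl => exact Set.empty_subset F
  | step h he hl ih =>
    rintro f (hf | hf)
    · exact ih hf.1
    · exact (Set.mem_singleton_iff.1 hf.1) ▸ he

open Classical in
lemma TreeWalk.boundary (hE : E(G).Finite) (hF : F ⊆ E(G)) (h : G.TreeWalk F r x Q) :
    G.boundary Q = Pi.single r 1 + Pi.single x 1 := by
  induction h with
  | refl => rw [boundary_empty, add_self_eq_zero_of_zmod_two]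
  | @step x y e Q h he hl ih =>
    rw [boundary_symmDiff _ (hE.subset (h.subset.trans hF)) (Set.finite_singleton e), ih,
      hl.boundary_singleton]
    have := add_self_eq_zero_of_zmod_two (Pi.single x 1)
    linear_combination this

lemma TreeWalk.unique (hE : E(G).Finite) (hF : F ⊆ E(G)) (hc : G.IsConservative F)
    (h : G.TreeWalk F r x Q) (h' : G.TreeWalk F r x Q') : Q = Q' := by
  classical
  rw [← symmDiff_eq_bot]
  refine hc.eq_empty hE hF ?_ ?_
  · rintro f (hf | hf)
    · exact h.subset hf.1
    · exact h'.subset hf.1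
  · rw [boundary_symmDiff _ (hE.subset (h.subset.trans hF)) (hE.subset (h'.subset.trans hF)),
      h.boundary hE hF, h'.boundary hE hF, add_self_eq_zero_of_zmod_two]

lemma TreeWalk.eq_empty (hE : E(G).Finite) (hF : F ⊆ E(G)) (hc : G.IsConservative F)
    (h : G.TreeWalk F r r Q) : Q = ∅ :=
  h.unique hE hF hc .refl

lemma Branch.treeWalk (h : G.Branch F r e₀ x Q) : G.TreeWalk F r x Q := by
  induction h with
  | start he hl hc =>
    have := TreeWalk.refl.step he hl
    rwa [← Set.bot_eq_empty, bot_symmDiff] at this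
  | step h he hl hy ih => exact ih.step he hl

lemma Branch.ne_root (h : G.Branch F r e₀ x Q) : x ≠ r := by
  cases h <;> assumption

lemma Branch.exists_isLink (h : G.Branch F r e₀ x Q) : e₀ ∈ F ∧ ∃ c, c ≠ r ∧ G.IsLink e₀ r c := by
  induction h with
  | start he hl hc => exact ⟨he, _, hc, hl⟩
  | step h he hl hy ih => exact ih

/-- Later steps avoid `r`, so they can never cancel `e₀`. Hence `e₀` marks the branch, as the only
edge of `Q` at `r`. -/
lemma Branch.edges (h : G.Branch F r e₀ x Q) : e₀ ∈ Q ∧ ∀ f ∈ Q, f ≠ e₀ →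
    ∃ u v Q₁ Q₂, G.IsLink f u v ∧ G.Branch F r e₀ u Q₁ ∧ G.Branch F r e₀ v Q₂ := by
  induction h with
  | start he hl hc => exact ⟨rfl, fun f hf hne ↦ (hne hf).elim⟩
  | @step x y e Q h he hl hy ih =>
    refine ⟨.inl ⟨ih.1, ?_⟩, ?_⟩
    · rintro rfl
      obtain ⟨-, c, -, hl'⟩ := h.exists_isLink
      rcases hl'.left_eq_or_eq hl with h1 | h1
      · exact h.ne_root h1.symm
      · exact hy h1.symm
    · rintro f (hf | hf) hne
      · exact ih.2 f hf.1 hne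
      · obtain rfl := Set.mem_singleton_iff.1 hf.1
        exact ⟨x, y, _, _, hl, h, h.step he hl hy⟩

lemma TreeWalk.eq_root_or_branch (hE : E(G).Finite) (hF : F ⊆ E(G)) (hc : G.IsConservative F)
    (h : G.TreeWalk F r x Q) : (x = r ∧ Q = ∅) ∨ ∃ e₀, G.Branch F r e₀ x Q := by
  induction h with
  | refl => exact .inl ⟨rfl, rfl⟩
  | @step x y e Q h he hl ih =>
    by_cases hy : y = r
    -- In a forest, a walk that has returned to `r` has cancelled completely, so it can be forgotten
    -- and the branch restarts with the next edge.
    · subst hy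
      exact .inl ⟨rfl, (h.step he hl).eq_empty hE hF hc⟩
    · right
      rcases ih with ⟨rfl, rfl⟩ | ⟨e₀, hb⟩
      · refine ⟨e, ?_⟩
        rw [← Set.bot_eq_empty, bot_symmDiff]
        exact .start he hl hy
      · exact ⟨e₀, hb.step he hl hy⟩

lemma Branch.edge_unique (hE : E(G).Finite) (hF : F ⊆ E(G)) (hc : G.IsConservative F)
    (h : G.Branch F r e₀ x Q) (h' : G.Branch F r e₁ x Q') : e₀ = e₁ := by
  by_contra hne
  have hQ := h.treeWalk.unique hE hF hc h'.treeWalk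
  obtain ⟨u, v, Q₁, Q₂, hl, hu, hv⟩ := h'.edges.2 e₀ (hQ ▸ h.edges.1) hne
  obtain ⟨-, c, -, hl'⟩ := h.exists_isLink
  rcases hl'.left_eq_or_eq hl with h1 | h1
  · exact hu.ne_root h1.symm
  · exact hv.ne_root h1.symm

/-- A first edge cannot lie in the other set, as it meets `r`. Any other common edge would have an
end reached through both `e₀` and `e₁`. -/
lemma Branch.disjoint (hE : E(G).Finite) (hF : F ⊆ E(G)) (hc : G.IsConservative F) (hne : e₀ ≠ e₁)
    (h : G.Branch F r e₀ x Q) (h' : G.Branch F r e₁ y Q') : Disjoint Q Q' := by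
  rw [Set.disjoint_left]
  intro f hf hf'
  have key : ∀ {e₀ e₁ x y Q Q'}, G.Branch F r e₀ x Q → G.Branch F r e₁ y Q' → e₀ ≠ e₁ →
      e₀ ∉ Q' := by
    intro e₀ e₁ x y Q Q' h h' hne hmem
    obtain ⟨u, v, Q₁, Q₂, hl, hu, hv⟩ := h'.edges.2 e₀ hmem hne
    obtain ⟨-, c, -, hl'⟩ := h.exists_isLink
    rcases hl'.left_eq_or_eq hl with h1 | h1
    · exact hu.ne_root h1.symm
    · exact hv.ne_root h1.symm
  have h0 : f ≠ e₀ := fun hh ↦ key h h' hne (hh ▸ hf')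
  have h1 : f ≠ e₁ := fun hh ↦ key h' h hne.symm (hh ▸ hf)
  obtain ⟨u, v, Q₁, Q₂, hl, hu, hv⟩ := h.edges.2 f hf h0
  obtain ⟨u', v', Q₁', Q₂', hl', hu', hv'⟩ := h'.edges.2 f hf' h1
  rcases hl.left_eq_or_eq hl' with rfl | rfl
  · exact hne (hu.edge_unique hE hF hc hu')
  · exact hne (hu.edge_unique hE hF hc hv')

lemma Climb.mono {P P' : α → Set β → Prop} (hP : ∀ z Q, P z Q → P' z Q)
    (h : G.Climb F P k v D) : G.Climb F P' k v D := by
  induction h with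
  | start h => exact .start (hP _ _ h)
  | step h he hl ih => exact ih.step he hl

lemma Climb.subset (hF : F ⊆ E(G)) (h : G.Climb F (G.TreeWalk F r) k v D) : D ⊆ E(G) := by
  induction h with
  | start h => exact h.subset.trans hF
  | @step k u v e D h he hl ih =>
    rintro f (hf | hf)
    · exact ih hf.1
    · exact (Set.mem_singleton_iff.1 hf.1) ▸ hl.edge_mem

open Classical in
lemma Climb.boundary (hE : E(G).Finite) (hF : F ⊆ E(G)) (h : G.Climb F (G.TreeWalk F r) k v D) :
    G.boundary D = Pi.single r 1 + Pi.single v 1 := by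
  induction h with
  | start h => exact h.boundary hE hF
  | @step k u v e D h he hl ih =>
    rw [boundary_symmDiff _ (hE.subset (h.subset hF)) (Set.finite_singleton e), ih,
      hl.boundary_singleton]
    have := add_self_eq_zero_of_zmod_two (Pi.single u 1)
    linear_combination this

/-- Steps outside `F` leave `D ∩ F` equal to the initial tree part. There is only an inequality
because repeated edges outside `F` cancel, which makes the length smaller still. -/
lemma Climb.ncard_le {P : α → Set β → Prop} (hP : ∀ z Q, P z Q → Q ⊆ F)
    (h : G.Climb F P k v D) : (∃ z, P z (D ∩ F)) ∧ (D \ F).Finite ∧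
      (D \ F).ncard + k ≤ (D ∩ F).ncard := by
  induction h with
  | @start z Q h =>
    rw [Set.inter_eq_left.2 (hP z Q h), Set.sdiff_eq_empty.2 (hP z Q h)]
    simpa using ⟨z, h⟩
  | @step k u v e D h he hl ih =>
    have h1 : symmDiff D {e} ∩ F = D ∩ F := by
      ext f
      by_cases hf : f = e
      · simp [hf, he]
      · simp [Set.mem_symmDiff, hf]
    have h2 : symmDiff D {e} \ F ⊆ insert e (D \ F) := by
      rintro f ⟨hf | hf, hfF⟩
      · exact .inr ⟨hf.1, hfF⟩
      · exact .inl hf.1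
    rw [h1]
    have h3 := Set.ncard_le_ncard h2 (ih.2.1.insert e)
    have h4 := Set.ncard_insert_le e (D \ F)
    exact ⟨ih.1, (ih.2.1.insert e).subset h2, by omega⟩

lemma Climb.eq_zero (hE : E(G).Finite) (hF : F ⊆ E(G)) (hc : G.IsConservative F)
    (h : G.Climb F (G.TreeWalk F r) k r D) : k = 0 := by
  classical
  have h1 := hc D (h.subset hF) (by rw [h.boundary hE hF, add_self_eq_zero_of_zmod_two])
  have h2 := (h.ncard_le (fun _ _ h ↦ h.subset)).2.2
  omega

lemma Climb.eq_root_or_branch (hE : E(G).Finite) (hF : F ⊆ E(G)) (hc : G.IsConservative F)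
    (h : G.Climb F (G.TreeWalk F r) k v D) :
    (v = r ∧ k = 0) ∨ ∃ e₀, G.Climb F (G.Branch F r e₀) k v D := by
  induction h with
  | start h =>
    rcases h.eq_root_or_branch hE hF hc with ⟨rfl, rfl⟩ | ⟨e₀, hb⟩
    · exact .inl ⟨rfl, Set.ncard_empty β⟩
    · exact .inr ⟨e₀, .start hb⟩
  | step h he hl ih =>
    rcases ih with ⟨-, h0⟩ | ⟨e₀, hb⟩
    -- A step outside `F` needs a positive counter, so it cannot start while the walk is still at
    -- `r` with counter 0.
    · exact (Nat.succ_ne_zero _ h0).elim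
    · exact .inr ⟨e₀, hb.step he hl⟩

lemma root_notMem_lowSet (hE : E(G).Finite) (hF : F ⊆ E(G)) (hc : G.IsConservative F) :
    r ∉ G.lowSet F r e₀ := by
  rintro ⟨k, D, h⟩
  exact Nat.succ_ne_zero k ((h.mono fun _ _ hb ↦ hb.treeWalk).eq_zero hE hF hc)

lemma Branch.mem_lowSet (hE : E(G).Finite) (hF : F ⊆ E(G)) (h : G.Branch F r e₀ x Q) :
    x ∈ G.lowSet F r e₀ := by
  have hpos := (Set.ncard_pos (hE.subset (h.treeWalk.subset.trans hF))).2 ⟨e₀, h.edges.1⟩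
  refine ⟨Q.ncard - 1, Q, ?_⟩
  rw [Nat.sub_add_cancel hpos]
  exact .start h

open Classical in
-- Two walks of length at most -1 and a link `W` of length at most 1 close up to an even set `C` of
-- length at most -1. The tree parts of the walks lie in different branches, so they do not cancel
-- each other. `W` is empty for a common vertex and a single edge for adjacent vertices.
lemma lowSet_separated (hE : E(G).Finite) (hF : F ⊆ E(G)) (hc : G.IsConservative F)
    (hne : e₀ ≠ e₁) (hu : u ∈ G.lowSet F r e₀) (hv : v ∈ G.lowSet F r e₁) {W : Set β}
    (hW : W ⊆ E(G)) (hW1 : W.ncard ≤ 1) (hWb : G.boundary W = Pi.single u 1 + Pi.single v 1) :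
    False := by
  obtain ⟨k, D, hD⟩ := hu
  obtain ⟨k', D', hD'⟩ := hv
  obtain ⟨⟨z, hz⟩, -, hcard⟩ := hD.ncard_le (fun _ _ h ↦ h.treeWalk.subset)
  obtain ⟨⟨z', hz'⟩, -, hcard'⟩ := hD'.ncard_le (fun _ _ h ↦ h.treeWalk.subset)
  have hdisj := hz.disjoint hE hF hc hne hz'
  have ht := hD.mono fun _ _ h ↦ h.treeWalk
  have ht' := hD'.mono fun _ _ h ↦ h.treeWalk
  have hDf := hE.subset (ht.subset hF)
  have hDf' := hE.subset (ht'.subset hF)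
  have hWf := hE.subset hW
  set C := symmDiff (symmDiff D D') W with hC
  have hCE : C ⊆ E(G) := by
    rintro f (⟨hf | hf, -⟩ | hf)
    · exact ht.subset hF hf.1
    · exact ht'.subset hF hf.1
    · exact hW hf.1
  have hCf := hE.subset hCE
  have hb : G.boundary C = 0 := by
    rw [hC, boundary_symmDiff _ (hE.subset ?_) hWf, boundary_symmDiff _ hDf hDf',
      ht.boundary hE hF, ht'.boundary hE hF, hWb]
    · have h1 := add_self_eq_zero_of_zmod_two (Pi.single r 1)
      have h2 := add_self_eq_zero_of_zmod_two (Pi.single u 1)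
      have h3 := add_self_eq_zero_of_zmod_two (Pi.single v 1)
      linear_combination h1 + h2 + h3
    · rintro f (hf | hf)
      · exact ht.subset hF hf.1
      · exact ht'.subset hF hf.1
  have hle := hc C hCE hb
  -- Edges of the disjoint tree parts can vanish from `C` only by cancelling with `W`.
  have h1 : (D ∩ F) ∪ (D' ∩ F) ⊆ (C ∩ F) ∪ (W ∩ F) := by
    have hd : ∀ f, f ∈ D ∩ F → f ∉ D' ∩ F := fun f h h' ↦ Set.disjoint_left.1 hdisj h h'
    intro f hf
    have := hd f
    simp only [hC, Set.mem_union, Set.mem_inter_iff, Set.mem_symmDiff] at this hf ⊢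
    tauto
  have h2 : C \ F ⊆ (D \ F) ∪ (D' \ F) ∪ (W \ F) := by
    intro f hf
    simp only [hC, Set.mem_union, Set.mem_sdiff, Set.mem_symmDiff] at hf ⊢
    tauto
  have h3 := Set.ncard_le_ncard h1 ((hCf.inter_of_left F).union (hWf.inter_of_left F))
  rw [Set.ncard_union_eq hdisj (hDf.inter_of_left F) (hDf'.inter_of_left F)] at h3
  have h4 := Set.ncard_le_ncard h2 ((hDf.sdiff.union hDf'.sdiff).union hWf.sdiff)
  have h5 := Set.ncard_union_le (C ∩ F) (W ∩ F)
  have h6 := Set.ncard_union_le ((D \ F) ∪ (D' \ F)) (W \ F)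
  have h7 := Set.ncard_union_le (D \ F) (D' \ F)
  have h8 := Set.ncard_inter_add_ncard_sdiff_eq_ncard W F hWf
  omega

lemma disjoint_lowSet (hE : E(G).Finite) (hF : F ⊆ E(G)) (hc : G.IsConservative F)
    (hne : e₀ ≠ e₁) : Disjoint (G.lowSet F r e₀) (G.lowSet F r e₁) := by
  classical
  rw [Set.disjoint_left]
  intro v hv hv'
  refine lowSet_separated hE hF hc hne hv hv' (Set.empty_subset _) (by simp) ?_
  rw [boundary_empty, add_self_eq_zero_of_zmod_two]

lemma IsLink.eq_of_mem_lowSet (hE : E(G).Finite) (hF : F ⊆ E(G)) (hc : G.IsConservative F)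
    {e : β} (h : G.IsLink e u v) (hu : u ∈ G.lowSet F r e₀) (hv : v ∈ G.lowSet F r e₁) :
    e₀ = e₁ := by
  classical
  by_contra hne
  exact lowSet_separated hE hF hc hne hu hv (Set.singleton_subset_iff.2 h.edge_mem) (by simp)
    h.boundary_singleton

lemma Climb.vertex_mem {P : α → Set β → Prop} (hP : ∀ z Q, P z Q → z ∈ V(G))
    (h : G.Climb F P k v D) : v ∈ V(G) := by
  cases h with
  | start h => exact hP _ _ h
  | step h he hl => exact hl.right_mem

lemma Branch.vertex_mem (h : G.Branch F r e₀ x Q) : x ∈ V(G) := by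
  cases h with
  | start he hl hc => exact hl.right_mem
  | step h he hl hy => exact hl.right_mem

lemma lowSet_subset : G.lowSet F r e₀ ⊆ V(G) := by
  rintro v ⟨k, D, h⟩
  exact h.vertex_mem fun _ _ h ↦ h.vertex_mem

lemma isLink_induce_edge_mem {K : Set α} {e : β} (h : G.IsLink e u v) (hu : u ∈ K) (hv : v ∈ K) :
    e ∈ E(G.induce K) :=
  ⟨u, v, h, hu, hv⟩

lemma Branch.treeWalk_induce (hE : E(G).Finite) (hF : F ⊆ E(G)) {c : α} (hl₀ : G.IsLink e₀ r c)
    (h : G.Branch F r e₀ x Q) :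
    (G.induce (G.lowSet F r e₀)).TreeWalk (F ∩ E(G.induce (G.lowSet F r e₀))) c x (Q \ {e₀}) := by
  induction h with
  | start he hl hc =>
    rw [hl.right_unique hl₀, Set.sdiff_self]
    exact .refl
  | @step x y e Q h he hl hy ih =>
    have hx := h.mem_lowSet hE hF
    have hy' := (h.step he hl hy).mem_lowSet hE hF
    have hne : e ≠ e₀ := by
      rintro rfl
      rcases hl₀.left_eq_or_eq hl with h1 | h1
      · exact h.ne_root h1.symm
      · exact hy h1.symm
    have hs : symmDiff Q {e} \ {e₀} = symmDiff (Q \ {e₀}) {e} := by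
      ext f
      have : f = e → f ≠ e₀ := fun h ↦ h ▸ hne
      simp only [Set.mem_sdiff, Set.mem_symmDiff, Set.mem_singleton_iff]
      tauto
    rw [hs]
    exact ih.step ⟨he, isLink_induce_edge_mem hl hx hy'⟩ ⟨hl, hx, hy'⟩

/-- Removing the first edge `e₀` lowers the counter by one. The counter never increases along the
steps outside `F`, so if it is positive at the end, the whole walk after `e₀` stays in the low set.
-/
lemma Climb.climb_induce (hE : E(G).Finite) (hF : F ⊆ E(G)) {c : α} (hl₀ : G.IsLink e₀ r c)
    (h : G.Climb F (G.Branch F r e₀) k v D) (hk : k ≠ 0) :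
    ∃ D', (G.induce (G.lowSet F r e₀)).Climb (F ∩ E(G.induce (G.lowSet F r e₀)))
      ((G.induce (G.lowSet F r e₀)).TreeWalk (F ∩ E(G.induce (G.lowSet F r e₀))) c)
      (k - 1) v D' := by
  induction h with
  | start h =>
    have := Climb.start (G := G.induce (G.lowSet F r e₀))
      (F := F ∩ E(G.induce (G.lowSet F r e₀))) (h.treeWalk_induce hE hF hl₀)
    rw [Set.ncard_sdiff_singleton_of_mem h.edges.1] at this
    exact ⟨_, this⟩
  | @step k u v e D h he hl ih =>
    obtain ⟨D', hD'⟩ := ih (Nat.succ_ne_zero k)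
    obtain ⟨k, rfl⟩ := Nat.exists_eq_succ_of_ne_zero hk
    exact ⟨_, hD'.step (fun hh ↦ he hh.1) ⟨hl, ⟨_, _, h⟩, ⟨_, _, h.step he hl⟩⟩⟩

/-- The vertices that can be reached by a walk of nonpositive length. -/
def reachSet (G : Graph α β) (F : Set β) (r : α) : Set α :=
  {v | ∃ k D, G.Climb F (G.TreeWalk F r) k v D}

lemma root_mem_reachSet : r ∈ G.reachSet F r := ⟨_, _, .start .refl⟩

lemma reachSet_subset (hr : r ∈ V(G)) : G.reachSet F r ⊆ V(G) := by
  rintro v ⟨k, D, h⟩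
  refine h.vertex_mem fun z Q hz ↦ ?_
  cases hz with
  | refl => exact hr
  | step h he hl => exact hl.right_mem

lemma TreeWalk.treeWalk_induce (h : G.TreeWalk F r x Q) :
    (G.induce (G.reachSet F r)).TreeWalk (F ∩ E(G.induce (G.reachSet F r))) r x Q := by
  induction h with
  | refl => exact .refl
  | step h he hl ih =>
    have hx : _ ∈ G.reachSet F r := ⟨_, _, .start h⟩
    have hy : _ ∈ G.reachSet F r := ⟨_, _, .start (h.step he hl)⟩
    exact ih.step ⟨he, isLink_induce_edge_mem hl hx hy⟩ ⟨hl, hx, hy⟩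

lemma Climb.climb_induce_reachSet (h : G.Climb F (G.TreeWalk F r) k v D) :
    (G.induce (G.reachSet F r)).Climb (F ∩ E(G.induce (G.reachSet F r)))
      ((G.induce (G.reachSet F r)).TreeWalk (F ∩ E(G.induce (G.reachSet F r))) r) k v D := by
  induction h with
  | start h => exact .start h.treeWalk_induce
  | step h he hl ih => exact ih.step (fun hh ↦ he hh.1) ⟨hl, ⟨_, _, h⟩, ⟨_, _, h.step he hl⟩⟩

lemma IsRooted.exists_treeWalk (h : G.IsRooted F r) {e : β} (he : e ∈ F) (hx : G.Inc e x) :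
    ∃ Q, G.TreeWalk F r x Q := by
  have h1 := h e he x hx
  clear hx
  induction h1 with
  | refl => exact ⟨_, .refl⟩
  | tail _ hs ih =>
    obtain ⟨f, hf, hl⟩ := hs
    obtain ⟨Q, hQ⟩ := ih
    exact ⟨_, hQ.step hf hl⟩

end Graph

/-! ### Contraction, and the passage to a low set. -/

namespace Graph

variable {α β : Type*}

/-- Contraction of pairwise separated vertex sets `K b` to new vertices `b`. -/
lemma exists_contraction (G : Graph α β) (B : Set α) (K : α → Set α) (hBV : Disjoint B V(G))
    (hKV : ∀ b ∈ B, K b ⊆ V(G)) (hne : ∀ b ∈ B, (K b).Nonempty)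
    (hdisj : ∀ b ∈ B, ∀ c ∈ B, b ≠ c → Disjoint (K b) (K c))
    (hsep : ∀ b ∈ B, ∀ c ∈ B, ∀ e u v, G.IsLink e u v → u ∈ K b → v ∈ K c → b = c) :
    ∃ G₀ : Graph α β, V(G₀) = {v | v ∈ V(G) ∧ ∀ b ∈ B, v ∉ K b} ∪ B ∧ E(G₀) ⊆ E(G) ∧
      (∀ b ∈ B, Disjoint E(G₀) E(G.induce (K b))) ∧
      (∀ e x y, x ∉ B → y ∉ B → (G₀.IsLink e x y ↔
        G.IsLink e x y ∧ (∀ b ∈ B, x ∉ K b) ∧ ∀ b ∈ B, y ∉ K b)) ∧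
      ∀ b ∈ B, ∀ e x, G₀.IsLink e x b ↔ (∀ c ∈ B, x ∉ K c) ∧ ∃ v ∈ K b, G.IsLink e x v := by
  classical
  obtain ⟨φ, hin, hout⟩ : ∃ φ : α → α, (∀ b ∈ B, ∀ v ∈ K b, φ v = b) ∧
      ∀ v, (∀ b ∈ B, v ∉ K b) → φ v = v := by
    refine ⟨fun v ↦ if h : ∃ b ∈ B, v ∈ K b then h.choose else v, fun b hb v hv ↦ ?_, fun v hv ↦ ?_⟩
    · have h : ∃ b ∈ B, v ∈ K b := ⟨b, hb, hv⟩
      simp only [dif_pos h]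
      by_contra hbc
      exact Set.disjoint_left.1 (hdisj _ h.choose_spec.1 b hb hbc) h.choose_spec.2 hv
    · have h : ¬ ∃ b ∈ B, v ∈ K b := fun ⟨b, hb, h⟩ ↦ hv b hb h
      simp only [dif_neg h]
  have hcase : ∀ v, (∀ b ∈ B, v ∉ K b) ∨ ∃ b ∈ B, v ∈ K b := fun v ↦ by
    by_cases h : ∃ b ∈ B, v ∈ K b
    · exact .inr h
    · exact .inl fun b hb hv ↦ h ⟨b, hb, hv⟩
  have hVB : ∀ v ∈ V(G), v ∉ B := fun v hv hb ↦ Set.disjoint_left.1 hBV hb hv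
  have hφB : ∀ v ∈ V(G), ∀ b ∈ B, φ v = b → v ∈ K b := by
    intro v hv b hb h
    rcases hcase v with h1 | ⟨c, hc, h1⟩
    · exact (hVB v hv (((hout v h1).symm.trans h) ▸ hb)).elim
    · exact ((hin c hc v h1).symm.trans h) ▸ h1
  have hφout : ∀ v ∈ V(G), φ v ∉ B → φ v = v ∧ ∀ b ∈ B, v ∉ K b := by
    intro v hv h
    rcases hcase v with h1 | ⟨c, hc, h1⟩
    · exact ⟨hout v h1, h1⟩
    · exact (h ((hin c hc v h1).symm ▸ hc)).elim
  -- Edges inside some `K b` are deleted first, since the contraction would turn them into loops at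
  -- `b`.
  set X : Set β := {e | ∀ b ∈ B, e ∉ E(G.induce (K b))} with hX
  refine ⟨(G.restrict X).map φ, ?_, ?_, ?_, ?_, ?_⟩
  · ext x
    constructor
    · rintro ⟨v, hv, rfl⟩
      rcases hcase v with h1 | ⟨c, hc, h1⟩
      · rw [hout v h1]
        exact .inl ⟨hv, h1⟩
      · rw [hin c hc v h1]
        exact .inr hc
    · rintro (⟨hx, hx'⟩ | hx)
      · exact ⟨x, hx, hout x hx'⟩
      · obtain ⟨v, hv⟩ := hne x hx
        exact ⟨v, hKV x hx hv, hin x hx v hv⟩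
  · exact fun e he ↦ he.1
  · intro b hb
    rw [Set.disjoint_left]
    exact fun e he he' ↦ he.2 b hb he'
  · intro e x y hx hy
    constructor
    · rintro ⟨u, v, ⟨-, hl⟩, rfl, rfl⟩
      obtain ⟨h1, h2⟩ := hφout u hl.left_mem hx
      obtain ⟨h3, h4⟩ := hφout v hl.right_mem hy
      rw [h1, h3]
      exact ⟨hl, h2, h4⟩
    · rintro ⟨hl, h1, h2⟩
      refine ⟨x, y, ⟨?_, hl⟩, hout x h1, hout y h2⟩
      rintro b hb ⟨u, v, hl', hu, hv⟩
      rcases hl.left_eq_or_eq hl' with rfl | rfl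
      · exact h1 b hb hu
      · exact h1 b hb hv
  · intro b hb e x
    constructor
    · rintro ⟨u, v, ⟨he, hl⟩, rfl, hvb⟩
      have hv := hφB v hl.right_mem b hb hvb
      rcases hcase u with h1 | ⟨c, hc, h1⟩
      · rw [hout u h1]
        exact ⟨h1, v, hv, hl⟩
      · obtain rfl := hsep c hc b hb e u v hl h1 hv
        exact (he c hc ⟨u, v, hl, h1, hv⟩).elim
    · rintro ⟨h1, v, hv, hl⟩
      refine ⟨x, v, ⟨?_, hl⟩, hout x h1, hin b hb v hv⟩
      rintro c hc ⟨u, w, hl', hu, hw⟩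
      rcases hl.left_eq_or_eq hl' with rfl | rfl
      · exact h1 c hc hu
      · exact h1 c hc hw

/-- `F` is conservative and connected to `r`, and every vertex can be reached from `r` by a walk
of nonpositive length. -/
structure IsReached (G : Graph α β) (F : Set β) (r : α) : Prop where
  root_mem : r ∈ V(G)
  finite_edgeSet : E(G).Finite
  subset : F ⊆ E(G)
  conservative : G.IsConservative F
  exists_treeWalk : ∀ e ∈ F, ∀ x, G.Inc e x → ∃ Q, G.TreeWalk F r x Q
  reach : ∀ v ∈ V(G), ∃ k D, G.Climb F (G.TreeWalk F r) k v D

variable {G : Graph α β} {F : Set β} {r x v c : α} {e e₀ e₁ : β}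

lemma exists_inc_of_climb {k : ℕ} {D : Set β} (h : G.Climb F (G.Branch F r e₀) k v D) :
    e₀ ∈ F ∧ G.Inc e₀ r := by
  obtain ⟨z, hz⟩ := (h.ncard_le fun _ _ h ↦ h.treeWalk.subset).1
  obtain ⟨h1, c, -, hl⟩ := hz.exists_isLink
  exact ⟨h1, c, hl⟩

namespace IsReached

lemma eq_root_or_mem_lowSet (h : G.IsReached F r) (he : e ∈ F) (hx : G.Inc e x) :
    x = r ∨ ∃ e₁ Q, G.Branch F r e₁ x Q := by
  obtain ⟨Q, hQ⟩ := h.exists_treeWalk e he x hx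
  rcases hQ.eq_root_or_branch h.finite_edgeSet h.subset h.conservative with ⟨h1, -⟩ | ⟨e₁, h1⟩
  · exact .inl h1
  · exact .inr ⟨e₁, Q, h1⟩

lemma ne_root (h : G.IsReached F r) (he : e ∈ F) (hl : G.IsLink e r x) : x ≠ r := by
  rintro rfl
  have h1 := (TreeWalk.refl.step he hl).eq_empty h.finite_edgeSet h.subset h.conservative
  rw [← Set.bot_eq_empty, bot_symmDiff] at h1
  exact Set.singleton_ne_empty e h1

lemma branch (h : G.IsReached F r) (he : e ∈ F) (hl : G.IsLink e r x) : G.Branch F r e x {e} :=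
  .start he hl (h.ne_root he hl)

lemma eq_of_branch_of_mem_lowSet (h : G.IsReached F r) {Q : Set β} (hb : G.Branch F r e₁ v Q)
    (hv : v ∈ G.lowSet F r e₀) : e₁ = e₀ := by
  by_contra hne
  exact Set.disjoint_left.1 (disjoint_lowSet h.finite_edgeSet h.subset h.conservative hne)
    (hb.mem_lowSet h.finite_edgeSet h.subset) hv

lemma root_notMem (h : G.IsReached F r) : r ∉ G.lowSet F r e₀ :=
  root_notMem_lowSet h.finite_edgeSet h.subset h.conservative

/-- This drives the induction: a low set satisfies the same hypotheses with the other end `c` of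
`e₀` as root. -/
lemma induce (h : G.IsReached F r) (he₀ : e₀ ∈ F) (hl₀ : G.IsLink e₀ r c) :
    (G.induce (G.lowSet F r e₀)).IsReached (F ∩ E(G.induce (G.lowSet F r e₀))) c where
  root_mem := (h.branch he₀ hl₀).mem_lowSet h.finite_edgeSet h.subset
  finite_edgeSet := h.finite_edgeSet.subset (induce_le lowSet_subset).edgeSet_mono
  subset := Set.inter_subset_right
  conservative := h.conservative.of_le (induce_le lowSet_subset)
  exists_treeWalk := by
    rintro e ⟨he, -⟩ x ⟨y, hl, hx, -⟩
    rcases h.eq_root_or_mem_lowSet he hl.inc_left with rfl | ⟨e₁, Q, hb⟩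
    · exact (h.root_notMem hx).elim
    · obtain rfl := h.eq_of_branch_of_mem_lowSet hb hx
      exact ⟨_, hb.treeWalk_induce h.finite_edgeSet h.subset hl₀⟩
  reach := by
    rintro v ⟨k, D, hD⟩
    obtain ⟨D', hD'⟩ := hD.climb_induce h.finite_edgeSet h.subset hl₀ (Nat.succ_ne_zero k)
    exact ⟨_, _, hD'⟩

open Classical in
-- `e₀` is the only edge of `F` that leaves the low set, so passing to the induced graph changes the
-- parity only at its end `c`.
lemma boundary_induce (h : G.IsReached F r) (he₀ : e₀ ∈ F) (hl₀ : G.IsLink e₀ r c)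
    (hv : v ∈ G.lowSet F r e₀) :
    (G.induce (G.lowSet F r e₀)).boundary (F ∩ E(G.induce (G.lowSet F r e₀))) v =
      G.boundary F v + if v = c then 1 else 0 := by
  have hvr : v ≠ r := fun hh ↦ h.root_notMem (hh ▸ hv)
  have h1 : G.boundary F v =
      G.boundary (symmDiff (F ∩ E(G.induce (G.lowSet F r e₀))) {e₀}) v := by
    refine boundary_congr fun e y hy ↦ and_congr_right fun hl ↦ ?_
    constructor
    · intro he
      rcases h.eq_root_or_mem_lowSet he hl.inc_right with rfl | ⟨e₁, Q, hb⟩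
      · obtain rfl := h.eq_of_branch_of_mem_lowSet (h.branch he hl.symm) hv
        refine .inr ⟨rfl, fun hh ↦ ?_⟩
        obtain ⟨a, b, hl', ha, hb⟩ := hh.2
        rcases hl.right_eq_or_eq hl' with rfl | rfl
        · exact h.root_notMem ha
        · exact h.root_notMem hb
      · have hy' := hb.mem_lowSet h.finite_edgeSet h.subset
        obtain rfl := hl.eq_of_mem_lowSet h.finite_edgeSet h.subset h.conservative hv hy'
        refine .inl ⟨⟨he, v, y, hl, hv, hy'⟩, ?_⟩
        rintro rfl
        rcases hl₀.left_eq_or_eq hl with rfl | rfl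
        · exact hvr rfl
        · exact hb.ne_root rfl
    · rintro (hh | hh)
      · exact hh.1.1
      · exact (Set.mem_singleton_iff.1 hh.1) ▸ he₀
  rw [h1, boundary_symmDiff _ (h.finite_edgeSet.subset (Set.inter_subset_left.trans h.subset))
    (Set.finite_singleton e₀), hl₀.boundary_singleton,
    boundary_of_le (induce_le lowSet_subset) Set.inter_subset_right]
  simp only [Pi.add_apply, Pi.single_apply, if_neg hvr, zero_add]
  have := CharTwo.add_self_eq_zero (if v = c then 1 else 0 : ZMod 2)
  linear_combination -this

lemma exists_branch_of_treeWalk_induce (h : G.IsReached F r) (he₀ : e₀ ∈ F)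
    (hl₀ : G.IsLink e₀ r c) {Q : Set β}
    (hQ : (G.induce (G.lowSet F r e₀)).TreeWalk (F ∩ E(G.induce (G.lowSet F r e₀))) c x Q) :
    G.Branch F r e₀ x (symmDiff {e₀} Q) := by
  induction hQ with
  | refl =>
    rw [← Set.bot_eq_empty, symmDiff_bot]
    exact h.branch he₀ hl₀
  | step hQ he hl ih =>
    rw [← symmDiff_assoc]
    exact ih.step he.1 hl.1 fun hh ↦ h.root_notMem (hh ▸ hl.2.2)

/-- Conversely to `Climb.climb_induce`, putting `e₀` in front adds an edge of `F` and raises the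
counter by one. -/
lemma exists_climb_of_climb_induce (h : G.IsReached F r) (he₀ : e₀ ∈ F)
    (hl₀ : G.IsLink e₀ r c) {k : ℕ} {D : Set β}
    (hD : (G.induce (G.lowSet F r e₀)).Climb (F ∩ E(G.induce (G.lowSet F r e₀)))
      ((G.induce (G.lowSet F r e₀)).TreeWalk (F ∩ E(G.induce (G.lowSet F r e₀))) c) k v D) :
    ∃ D', G.Climb F (G.Branch F r e₀) (k + 1) v D' := by
  induction hD with
  | @start z Q hQ =>
    have hb := h.exists_branch_of_treeWalk_induce he₀ hl₀ hQ
    have hnot : e₀ ∉ Q := by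
      intro hh
      obtain ⟨a, b, hl', ha, hb⟩ := (hQ.subset hh).2
      rcases hl₀.left_eq_or_eq hl' with rfl | rfl
      · exact h.root_notMem ha
      · exact h.root_notMem hb
    have hQf := h.finite_edgeSet.subset ((hQ.subset.trans Set.inter_subset_left).trans h.subset)
    have heq : symmDiff {e₀} Q = insert e₀ Q := by
      rw [Set.insert_eq, (Set.disjoint_singleton_left.2 hnot).symmDiff_eq_sup]
      rfl
    rw [heq] at hb
    have := Climb.start (G := G) (F := F) hb
    rw [Set.ncard_insert_of_notMem hnot hQf] at this
    exact ⟨_, this⟩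
  | step hD he hl ih =>
    obtain ⟨D', hD'⟩ := ih
    exact ⟨_, hD'.step (fun hh ↦ he ⟨hh, isLink_induce_edge_mem hl.1 hl.2.1 hl.2.2⟩) hl.1⟩

end IsReached

end Graph

/-! ### Vertices reached with length zero but not less. -/

namespace Graph

variable {α β : Type*} {G : Graph α β} {F : Set β} {r x v c : α} {e e₀ e₁ : β}

/-- The vertices that cannot be reached from `r` by a walk of negative length. -/
def exactSet (G : Graph α β) (F : Set β) (r : α) : Set α :=
  {v | v ∈ V(G) ∧ ¬ ∃ k D, G.Climb F (G.TreeWalk F r) (k + 1) v D}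

namespace IsReached

lemma root_mem_exactSet (h : G.IsReached F r) : r ∈ G.exactSet F r := by
  refine ⟨h.root_mem, ?_⟩
  rintro ⟨k, D, hD⟩
  exact Nat.succ_ne_zero k (hD.eq_zero h.finite_edgeSet h.subset h.conservative)

lemma mem_exactSet_iff (h : G.IsReached F r) :
    v ∈ G.exactSet F r ↔ v ∈ V(G) ∧ ∀ e₀ ∈ F, G.Inc e₀ r → v ∉ G.lowSet F r e₀ := by
  refine and_congr_right fun _ ↦ ⟨?_, ?_⟩
  · rintro hv e₀ - - ⟨k, D, hD⟩
    exact hv ⟨k, D, hD.mono fun _ _ hb ↦ hb.treeWalk⟩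
  · rintro hv ⟨k, D, hD⟩
    rcases hD.eq_root_or_branch h.finite_edgeSet h.subset h.conservative with ⟨-, h0⟩ | ⟨e₀, hb⟩
    · exact Nat.succ_ne_zero k h0
    · obtain ⟨h1, h2⟩ := exists_inc_of_climb hb
      exact hv e₀ h1 h2 ⟨k, D, hb⟩

/-- The last step of a climb to `v` starts at a vertex with positive counter, hence in a low set. A
climb without such a step would put `v` itself into a low set. -/
lemma exists_adj_lowSet (h : G.IsReached F r) (hv : v ∈ G.exactSet F r) (hvr : v ≠ r) :
    ∃ e₀ ∈ F, G.Inc e₀ r ∧ ∃ u ∈ G.lowSet F r e₀, G.Adj v u := by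
  obtain ⟨k, D, hD⟩ := h.reach v hv.1
  rcases hD.eq_root_or_branch h.finite_edgeSet h.subset h.conservative with ⟨h0, -⟩ | ⟨e₀, hb⟩
  · exact (hvr h0).elim
  · obtain ⟨h1, h2⟩ := exists_inc_of_climb hb
    refine ⟨e₀, h1, h2, ?_⟩
    cases hb with
    | start hb =>
      exact (((h.mem_exactSet_iff).1 hv).2 e₀ h1 h2 (hb.mem_lowSet h.finite_edgeSet h.subset)).elim
    | step hb he hl => exact ⟨_, ⟨k, _, hb⟩, _, hl.symm⟩

/-- An edge of `F` at `x` forces `x = r` and `v = c`. For an edge outside `F`, a negative walk from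
`c` to `v` would extend through `e₀` and `e` to a negative walk from `r` to `x`. -/
lemma mem_exactSet_induce (h : G.IsReached F r) (he₀ : e₀ ∈ F) (hl₀ : G.IsLink e₀ r c)
    (hx : x ∈ G.exactSet F r) (hv : v ∈ G.lowSet F r e₀) (hl : G.IsLink e x v) :
    v ∈ (G.induce (G.lowSet F r e₀)).exactSet (F ∩ E(G.induce (G.lowSet F r e₀))) c := by
  by_cases he : e ∈ F
  · have hxr : x = r := by
      rcases h.eq_root_or_mem_lowSet he hl.inc_left with h1 | ⟨e₁, Q, hb⟩
      · exact h1
      · obtain ⟨h1, c', -, h2⟩ := hb.exists_isLink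
        exact (((h.mem_exactSet_iff).1 hx).2 e₁ h1 ⟨c', h2⟩
          (hb.mem_lowSet h.finite_edgeSet h.subset)).elim
    subst hxr
    obtain rfl := h.eq_of_branch_of_mem_lowSet (h.branch he hl) hv
    obtain rfl := hl.right_unique hl₀
    exact (h.induce he₀ hl₀).root_mem_exactSet
  · refine ⟨hv, ?_⟩
    rintro ⟨k, D, hD⟩
    obtain ⟨D', hD'⟩ := h.exists_climb_of_climb_induce he₀ hl₀ hD
    -- The counter at `v` is `k + 1` in the piece and `k + 2` in `G`, so `k + 1` is left at `x`.
    exact ((h.mem_exactSet_iff).1 hx).2 e₀ he₀ hl₀.inc_left ⟨k, _, hD'.step he hl.symm⟩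

lemma eq_singleton (h : G.IsReached F r) (h0 : ∀ e ∈ F, ¬ G.Inc e r) : V(G) = {r} := by
  ext v
  constructor
  · intro hv
    obtain ⟨k, D, hD⟩ := h.reach v hv
    rcases hD.eq_root_or_branch h.finite_edgeSet h.subset h.conservative with ⟨h1, -⟩ | ⟨e₀, hb⟩
    · exact h1
    · obtain ⟨h1, h2⟩ := exists_inc_of_climb hb
      exact (h0 e₀ h1 h2).elim
  · rintro rfl
    exact h.root_mem

lemma ncard_lowSet_lt (h : G.IsReached F r) (hV : V(G).Finite) :
    (G.lowSet F r e₀).ncard < V(G).ncard :=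
  Set.ncard_lt_ncard ⟨lowSet_subset, fun hh ↦ h.root_notMem (hh h.root_mem)⟩ hV

end IsReached

end Graph

/-! ### Decomposition into a rake and smaller pieces. -/

namespace Graft

variable {α β : Type*}

open Classical in
/-- A graph with the set `T` of which a given edge set is a join. -/
def ofBoundary (G : Graph α β) (F : Set β) (T : Set α) (hV : V(G).Finite) (hE : E(G).Finite)
    (hF : F ⊆ E(G)) (hTV : T ⊆ V(G)) (hT : ∀ v ∈ V(G), G.boundary F v = if v ∈ T then 1 else 0) :
    Graft α β where
  graph := G
  T := T
  finite_vertexSet := hV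
  finite_edgeSet := hE
  T_subset := hTV
  even_component x hx := by
    refine Graph.even_ncard_inter_of_boundary (hV.subset fun v hv ↦ hv.1) ?_ (hE.subset hF) hF
      fun v hv ↦ hT v hv.1
    intro e u v hl
    constructor
    · exact fun hu ↦ ⟨hl.right_mem, hu.2.tail hl.adj⟩
    · exact fun hv ↦ ⟨hl.left_mem, hv.2.tail hl.symm.adj⟩

/-- The piece of `G` that is glued to a rake at the edge `e₀`. -/
lemma exists_piece {G : Graft α β} {F : Set β} {r c : α} {e₀ : β} (h : G.graph.IsReached F r)
    (hF : G.IsJoin F) (he₀ : e₀ ∈ F) (hl₀ : G.graph.IsLink e₀ r c) :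
    ∃ H : Graft α β, H.graph = G.graph.induce (G.graph.lowSet F r e₀) ∧
      H.T = symmDiff (G.T ∩ G.graph.lowSet F r e₀) {c} ∧
      H.IsJoin (F ∩ E(G.graph.induce (G.graph.lowSet F r e₀))) := by
  classical
  have hle : G.graph.induce (G.graph.lowSet F r e₀) ≤ G.graph :=
    Graph.induce_le Graph.lowSet_subset
  have hbd : ∀ v ∈ V(G.graph.induce (G.graph.lowSet F r e₀)),
      (G.graph.induce (G.graph.lowSet F r e₀)).boundary
        (F ∩ E(G.graph.induce (G.graph.lowSet F r e₀))) v =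
      if v ∈ symmDiff (G.T ∩ G.graph.lowSet F r e₀) {c} then 1 else 0 := by
    intro v hv
    rw [h.boundary_induce he₀ hl₀ hv, Set.ite_mem_symmDiff_zmod_two,
      (isJoin_iff_boundary.1 hF).2 v (Graph.lowSet_subset hv)]
    have hv' : v ∈ G.graph.lowSet F r e₀ := hv
    simp [hv']
  have hTV : symmDiff (G.T ∩ G.graph.lowSet F r e₀) {c} ⊆
      V(G.graph.induce (G.graph.lowSet F r e₀)) := by
    rintro v (hv | hv)
    · exact hv.1.2
    · rw [Set.mem_singleton_iff.1 hv.1]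
      exact (h.induce he₀ hl₀).root_mem
  refine ⟨ofBoundary (G.graph.induce (G.graph.lowSet F r e₀)) _ _
    (G.finite_vertexSet.subset Graph.lowSet_subset) (G.finite_edgeSet.subset hle.edgeSet_mono)
    Set.inter_subset_right hTV hbd, rfl, rfl, ?_⟩
  exact isJoin_iff_boundary.2 ⟨Set.inter_subset_right, hbd⟩

lemma mem_T_eq_root_or_branch {G : Graft α β} {F : Set β} {r v : α} (h : G.graph.IsReached F r)
    (hF : G.IsJoin F) (hv : v ∈ G.T) : v = r ∨ ∃ e₁ Q, G.graph.Branch F r e₁ v Q := by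
  classical
  obtain ⟨e, he, heF⟩ := nonempty_cut_inter_of_boundary (G := G.graph) (F := F) (v := v)
    (by rw [(isJoin_iff_boundary.1 hF).2 v (G.T_subset hv), if_pos hv])
  obtain ⟨y, -, hl⟩ := Graph.mem_cut_singleton.1 he
  exact h.eq_root_or_mem_lowSet heF hl.inc_left

/-- Contracting the low sets, one for each edge of `F` at `r`, gives a rake whose teeth are the new
vertices; `G` is the gluing sum that undoes the contraction. `Infinite α` supplies names for the
teeth outside the finite set `V(G)`. -/
lemma memP_exactSet_of_pieces [Infinite α] {G : Graft α β} {F : Set β} {r : α}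
    (h : G.graph.IsReached F r) (hF : G.IsJoin F)
    (hpiece : ∀ e₀ ∈ F, ∀ c, G.graph.IsLink e₀ r c → ∃ H : Graft α β,
      H.graph = G.graph.induce (G.graph.lowSet F r e₀) ∧
      H.T = symmDiff (G.T ∩ G.graph.lowSet F r e₀) {c} ∧
      MemP c (H.graph.exactSet (F ∩ E(G.graph.induce (G.graph.lowSet F r e₀))) c) H) :
    MemP r (G.graph.exactSet F r) G := by
  classical
  have hFf := G.finite_edgeSet.subset h.subset
  -- If no edge of `F` meets `r`, no walk leaves `r`, and `G` is a rake without teeth on the single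
  -- vertex `r`.
  by_cases h0 : ∀ e ∈ F, ¬ G.graph.Inc e r
  · have hV := h.eq_singleton h0
    have hT : G.T = ∅ := by
      refine Set.eq_empty_of_forall_notMem fun v hv ↦ ?_
      obtain ⟨e, he, heF⟩ := nonempty_cut_inter_of_boundary (G := G.graph) (F := F) (v := v)
        (by rw [(isJoin_iff_boundary.1 hF).2 v (G.T_subset hv), if_pos hv])
      obtain ⟨y, -, hl⟩ := Graph.mem_cut_singleton.1 he
      have hvr : v = r := by
        have := hl.left_mem
        rwa [hV] at this
      exact h0 e heF (hvr ▸ hl.inc_left)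
    have hA : G.graph.exactSet F r = V(G.graph) \ ∅ := by
      rw [Set.sdiff_empty]
      refine subset_antisymm (fun v hv ↦ hv.1) fun v hv ↦ ?_
      rw [hV] at hv
      exact (Set.mem_singleton_iff.1 hv) ▸ h.root_mem_exactSet
    rw [hA]
    refine .base r ∅ G (IsRake.memR ?_)
    refine ⟨h.root_mem, Set.notMem_empty r, Set.empty_subset _, by simp, by simp, ?_, by simp [hT],
      by simp [hT]⟩
    rintro x ⟨hx, -⟩ hxr
    rw [hV] at hx
    exact (hxr hx).elim
  push Not at h0
  obtain ⟨e', he'F, he'r⟩ := h0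
  have : Nonempty β := ⟨e'⟩
  have : Nonempty α := ⟨r⟩
  set N : Set β := {e | e ∈ F ∧ G.graph.Inc e r} with hN
  have hNf : N.Finite := hFf.subset fun e he ↦ he.1
  -- fresh names for the sets to be contracted
  obtain ⟨nm, hnmV, hnm⟩ := hNf.exists_injOn_of_encard_le (t := V(G.graph)ᶜ)
    (by rw [G.finite_vertexSet.infinite_compl.encard_eq]; exact le_top)
  set B : Set α := nm '' N with hB
  have hBf : B.Finite := hNf.image nm
  have hBV : Disjoint B V(G.graph) := by
    rw [Set.disjoint_left]
    rintro _ ⟨e, he, rfl⟩ hV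
    exact hnmV he hV
  have hVB : ∀ v ∈ V(G.graph), v ∉ B := fun v hv hb ↦ Set.disjoint_left.1 hBV hb hv
  have hexε : ∀ b ∈ B, ∃ e ∈ N, nm e = b := fun b hb ↦ hb
  choose! ε hεN hεnm using hexε
  have hεnm' : ∀ e ∈ N, nm e ∈ B ∧ ε (nm e) = e := fun e he ↦
    ⟨⟨e, he, rfl⟩, hnm (hεN _ ⟨e, he, rfl⟩) he (hεnm _ ⟨e, he, rfl⟩)⟩
  have hεinj : ∀ b ∈ B, ∀ c ∈ B, ε b = ε c → b = c := fun b hb c hc hbc ↦ by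
    rw [← hεnm b hb, ← hεnm c hc, hbc]
  have hexc : ∀ b ∈ B, ∃ c, G.graph.IsLink (ε b) r c := fun b hb ↦ by
    obtain ⟨c, hc⟩ := (hεN b hb).2
    exact ⟨c, hc.symm.symm⟩
  choose! c hc using hexc
  have hexH := fun b hb ↦ hpiece (ε b) (hεN b hb).1 (c b) (hc b hb)
  have : Nonempty (Graft α β) := ⟨G⟩
  choose! H hHg hHT hHP using hexH
  set K : α → Set α := fun b ↦ G.graph.lowSet F r (ε b) with hK
  have hcK : ∀ b ∈ B, c b ∈ K b := fun b hb ↦ (h.induce (hεN b hb).1 (hc b hb)).root_mem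
  have hsep : ∀ b ∈ B, ∀ d ∈ B, ∀ e u v, G.graph.IsLink e u v → u ∈ K b → v ∈ K d → b = d :=
    fun b hb d hd e u v hl hu hv ↦ hεinj b hb d hd
      (hl.eq_of_mem_lowSet h.finite_edgeSet h.subset h.conservative hu hv)
  have hdisj : ∀ b ∈ B, ∀ d ∈ B, b ≠ d → Disjoint (K b) (K d) := fun b hb d hd hbd ↦
    Graph.disjoint_lowSet h.finite_edgeSet h.subset h.conservative
      fun hh ↦ hbd (hεinj b hb d hd hh)
  have hexact : ∀ v, v ∈ G.graph.exactSet F r ↔ v ∈ V(G.graph) ∧ ∀ b ∈ B, v ∉ K b := by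
    intro v
    rw [h.mem_exactSet_iff]
    refine and_congr_right fun _ ↦ ⟨fun hh b hb ↦ hh _ (hεN b hb).1 (hεN b hb).2, ?_⟩
    intro hh e he her hv
    obtain ⟨h1, h2⟩ := hεnm' e ⟨he, her⟩
    exact hh _ h1 (by simpa only [hK, h2] using hv)
  have hbranch : ∀ e₁ v Q, G.graph.Branch F r e₁ v Q → ∃ b ∈ B, v ∈ K b := by
    intro e₁ v Q hb
    obtain ⟨h1, d, -, h2⟩ := hb.exists_isLink
    obtain ⟨h3, h4⟩ := hεnm' e₁ ⟨h1, d, h2⟩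
    refine ⟨_, h3, ?_⟩
    simpa only [hK, h4] using hb.mem_lowSet h.finite_edgeSet h.subset
  have hrout : ∀ b ∈ B, r ∉ K b := fun b _ ↦ h.root_notMem
  obtain ⟨g, hgV, hgE, hgd, hg1, hg2⟩ := Graph.exists_contraction G.graph B K hBV
    (fun b _ ↦ Graph.lowSet_subset) (fun b hb ↦ ⟨c b, hcK b hb⟩) hdisj hsep
  have hrV : r ∈ V(g) := by
    rw [hgV]
    exact .inl ⟨h.root_mem, hrout⟩
  have hrB : r ∉ B := hVB r h.root_mem
  have hlε : ∀ b ∈ B, g.IsLink (ε b) r b := fun b hb ↦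
    (hg2 b hb _ _).2 ⟨hrout, c b, hcK b hb, hc b hb⟩
  have hadj : ∀ b ∈ B, g.Adj r b := fun b hb ↦ ⟨_, hlε b hb⟩
  have hexadj : ∀ x ∈ V(g) \ B, x ≠ r → ∃ b ∈ B, g.Adj x b := by
    rintro x ⟨hx, hxB⟩ hxr
    rw [hgV] at hx
    have hx' := hx.resolve_right hxB
    obtain ⟨e, he, her, u, hu, f, hl⟩ := h.exists_adj_lowSet ((hexact x).2 hx') hxr
    obtain ⟨h1, h2⟩ := hεnm' e ⟨he, her⟩
    exact ⟨_, h1, f, (hg2 _ h1 _ _).2 ⟨hx'.2, u, by simpa only [hK, h2] using hu, hl⟩⟩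
  set T₀ : Set α := {v | v ∈ G.T ∧ ∀ b ∈ B, v ∉ K b} ∪ B with hT₀
  have hTmem : ∀ v, v ≠ r → (v ∈ T₀ ↔ v ∈ B) := by
    intro v hvr
    refine ⟨?_, .inr⟩
    rintro (⟨hv, hvK⟩ | hv)
    · rcases mem_T_eq_root_or_branch h hF hv with h1 | ⟨e₁, Q, hb⟩
      · exact (hvr h1).elim
      · obtain ⟨b, hb, hvb⟩ := hbranch _ _ _ hb
        exact (hvK b hb hvb).elim
    · exact hv
  -- The edges of `F` at `r` correspond to the teeth, so the join condition at `r` compares `T` with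
  -- the parity of `B`.
  have hrT : r ∈ T₀ ↔ Odd B.ncard := by
    have hcut : G.graph.cut {r} ∩ F = N := by
      ext e
      constructor
      · rintro ⟨he, heF⟩
        obtain ⟨y, -, hl⟩ := Graph.mem_cut_singleton.1 he
        exact ⟨heF, y, hl⟩
      · rintro ⟨heF, y, hl⟩
        exact ⟨Graph.mem_cut_singleton.2 ⟨y, h.ne_root heF hl, hl⟩, heF⟩
    have hb := (isJoin_iff_boundary.1 hF).2 r h.root_mem
    rw [Graph.boundary, hcut] at hb
    rw [hB, hnm.ncard_image, ← ZMod.natCast_eq_one_iff_odd, hb]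
    have : r ∈ T₀ ↔ r ∈ G.T :=
      ⟨fun hh ↦ (hh.resolve_right hrB).1, fun hh ↦ .inl ⟨hh, hrout⟩⟩
    rw [this]
    split_ifs with hr <;> simp [hr]
  have hT₀V : T₀ ⊆ V(g) := by
    rw [hgV]
    exact Set.union_subset_union_left _ fun v hv ↦ ⟨G.T_subset hv.1, hv.2⟩
  have hconn := Graph.isConnected_of_adj hrV hadj hexadj
  let G₀ : Graft α β :=
    { graph := g
      T := T₀
      finite_vertexSet := by
        rw [hgV]
        exact (G.finite_vertexSet.subset fun v hv ↦ hv.1).union hBf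
      finite_edgeSet := G.finite_edgeSet.subset hgE
      T_subset := hT₀V
      even_component := hconn.even_component hT₀V (even_ncard_of_mem_iff hBf hrB hTmem hrT) }
  have hBg : B ⊆ V(g) := by
    rw [hgV]
    exact Set.subset_union_right
  have hstable : ∀ e x y, g.IsLink e x y → x ∈ B → y ∉ B := by
    intro e x y hl hx hy
    obtain ⟨-, v, -, hl'⟩ := (hg2 y hy _ _).1 hl
    exact hVB x hl'.left_mem hx
  have hrake : IsRake r B G₀ :=
    ⟨hrV, hrB, hBg, hstable, hadj, hexadj, hTmem, hrT⟩
  have hHV : ∀ b ∈ B, V((H b).graph) = K b := fun b hb ↦ by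
    rw [hHg b hb]
    rfl
  have hHl : ∀ b ∈ B, ∀ e u v, (H b).graph.IsLink e u v ↔
      G.graph.IsLink e u v ∧ u ∈ K b ∧ v ∈ K b := fun b hb e u v ↦ by
    rw [hHg b hb]
    rfl
  -- the attachments
  have hexf : ∀ b ∈ B, ∀ e, e ∈ g.cut {b} → ∃ v ∈ K b, ∃ x, (∀ d ∈ B, x ∉ K d) ∧
      G.graph.IsLink e x v := by
    intro b hb e he
    obtain ⟨x, -, hl⟩ := Graph.mem_cut_singleton.1 he
    obtain ⟨h1, v, hv, hl'⟩ := (hg2 b hb _ _).1 hl.symm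
    exact ⟨v, hv, x, h1, hl'⟩
  choose! f hfK hf using hexf
  -- The other end of the edge is outside all contracted sets, so the end in `K b` is determined by
  -- the edge.
  have hf_eq : ∀ b ∈ B, ∀ e x v, (∀ d ∈ B, x ∉ K d) → v ∈ K b → G.graph.IsLink e x v →
      g.IsLink e x b ∧ v = f b e := by
    intro b hb e x v hx hv hl
    have hgl := (hg2 b hb e x).2 ⟨hx, v, hv, hl⟩
    have hxb : x ≠ b := fun hh ↦ hVB x hl.left_mem (hh ▸ hb)
    have hcut : e ∈ g.cut {b} := Graph.mem_cut_singleton.2 ⟨x, hxb, hgl.symm⟩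
    obtain ⟨y, hy, hl'⟩ := hf b hb e hcut
    rcases hl.right_eq_or_eq hl' with h1 | h1
    · exact (hy b hb (h1 ▸ hv)).elim
    · exact ⟨hgl, h1⟩
  have hf_link : ∀ b ∈ B, ∀ e x, g.IsLink e x b → G.graph.IsLink e x (f b e) := by
    intro b hb e x hl
    obtain ⟨h1, v, hv, hl'⟩ := (hg2 b hb e x).1 hl
    rw [← (hf_eq b hb e x v h1 hv hl').2]
    exact hl'
  have hglue : IsGluingSum G₀ B ε H
      (fun b ↦ (H b).graph.exactSet (F ∩ E(G.graph.induce (K b))) (c b)) c G := by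
    refine
      { connected := hconn
        S_subset := Set.subset_union_right
        S_nonempty := ⟨_, (hεnm' e' ⟨he'F, he'r⟩).1⟩
        S_stable := ⟨hBg, Set.eq_empty_of_forall_notMem ?_⟩
        ε_mem := fun b hb ↦ Graph.mem_cut_singleton.2
          ⟨r, fun hh ↦ hrB (hh ▸ hb), (hlε b hb).symm⟩
        disjoint_vertex := fun b hb ↦ ?_
        disjoint_edge := fun b hb ↦ ?_
        pairwise_disjoint_vertex := fun b hb d hd hbd ↦ ?_
        pairwise_disjoint_edge := fun b hb d hd hbd ↦ ?_
        A_subset := fun b hb v hv ↦ hv.1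
        ρ_mem := fun b hb ↦ ?_
        vertexSet_eq := ?_
        exists_attachment := ⟨f, fun b hb e he ↦ ?_, fun b hb ↦ ?_, fun e u v ↦ ?_⟩
        T_eq := ?_ }
    · rintro e ⟨x, hx, y, hy, hl⟩
      exact hstable e x y hl hx hy
    · rw [hHV b hb, Set.disjoint_left]
      intro v hv hvK
      change v ∈ V(g) at hv
      rw [hgV] at hv
      rcases hv with hv | hv
      · exact hv.2 b hb hvK
      · exact hVB v (Graph.lowSet_subset hvK) hv
    · rw [hHg b hb]
      exact hgd b hb
    · rw [hHV b hb, hHV d hd]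
      exact hdisj b hb d hd hbd
    · rw [hHg b hb, hHg d hd, Set.disjoint_left]
      rintro e ⟨u, v, hl, hu, hv⟩ ⟨u', v', hl', hu', hv'⟩
      rcases hl.left_eq_or_eq hl' with rfl | rfl
      · exact Set.disjoint_left.1 (hdisj b hb d hd hbd) hu hu'
      · exact Set.disjoint_left.1 (hdisj b hb d hd hbd) hu hv'
    · rw [hHg b hb]
      exact (h.induce (hεN b hb).1 (hc b hb)).root_mem_exactSet
    · change _ = V(g) \ B ∪ _
      rw [hgV]
      ext v
      constructor
      · intro hv
        by_cases hvK : ∀ b ∈ B, v ∉ K b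
        · exact .inl ⟨.inl ⟨hv, hvK⟩, hVB v hv⟩
        · push Not at hvK
          obtain ⟨b, hb, hvb⟩ := hvK
          exact .inr (Set.mem_biUnion hb (by rwa [hHV b hb]))
      · rintro (⟨hv, hvB⟩ | hv)
        · exact (hv.resolve_right hvB).1
        · simp only [Set.mem_iUnion] at hv
          obtain ⟨b, hb, hv⟩ := hv
          rw [hHV b hb] at hv
          exact Graph.lowSet_subset hv
    · obtain ⟨x, hx, hl⟩ := hf b hb e he
      simp only [hHg b hb]
      exact h.mem_exactSet_induce (hεN b hb).1 (hc b hb) ((hexact x).2 ⟨hl.left_mem, hx⟩)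
        (hfK b hb e he) hl
    · exact (hf_eq b hb _ _ _ hrout (hcK b hb) (hc b hb)).2.symm
    · constructor
      · intro hl
        by_cases hu : ∀ b ∈ B, u ∉ K b <;> by_cases hv : ∀ b ∈ B, v ∉ K b
        · have huB := hVB u hl.left_mem
          have hvB := hVB v hl.right_mem
          exact .inl ⟨huB, hvB, (hg1 e u v huB hvB).2 ⟨hl, hu, hv⟩⟩
        · push Not at hv
          obtain ⟨b, hb, hvb⟩ := hv
          exact .inr (.inr (.inl ⟨b, hb, hVB u hl.left_mem, hf_eq b hb e u v hu hvb hl⟩))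
        · push Not at hu
          obtain ⟨b, hb, hub⟩ := hu
          exact .inr (.inr (.inr ⟨b, hb, hVB v hl.right_mem, hf_eq b hb e v u hv hub hl.symm⟩))
        · push Not at hu hv
          obtain ⟨b, hb, hub⟩ := hu
          obtain ⟨d, hd, hvd⟩ := hv
          obtain rfl := hsep b hb d hd e u v hl hub hvd
          exact .inr (.inl ⟨b, hb, (hHl b hb e u v).2 ⟨hl, hub, hvd⟩⟩)
      · rintro (⟨hu, hv, hl⟩ | ⟨b, hb, hl⟩ | ⟨b, hb, -, hl, rfl⟩ | ⟨b, hb, -, hl, rfl⟩)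
        · exact ((hg1 e u v hu hv).1 hl).1
        · exact ((hHl b hb e u v).1 hl).1
        · exact hf_link b hb e u hl
        · exact (hf_link b hb e v hl).symm
    · change _ = T₀ \ B ∪ _
      -- The change at `c b` made in the piece is undone by the one in the gluing sum.
      have hTb : ∀ b ∈ B, symmDiff (H b).T {c b} = G.T ∩ K b := fun b hb ↦ by
        rw [hHT b hb, symmDiff_symmDiff_cancel_right]
      ext v
      constructor
      · intro hv
        by_cases hvK : ∀ b ∈ B, v ∉ K b
        · exact .inl ⟨.inl ⟨hv, hvK⟩, hVB v (G.T_subset hv)⟩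
        · push Not at hvK
          obtain ⟨b, hb, hvb⟩ := hvK
          exact .inr (Set.mem_biUnion hb (by rw [hTb b hb]; exact ⟨hv, hvb⟩))
      · rintro (⟨hv, hvB⟩ | hv)
        · exact (hv.resolve_right hvB).1
        · simp only [Set.mem_iUnion] at hv
          obtain ⟨b, hb, hv⟩ := hv
          rw [hTb b hb] at hv
          exact hv.1
  have hA : G.graph.exactSet F r = V(G₀.graph) \ B := by
    change _ = V(g) \ B
    rw [hgV]
    ext v
    rw [hexact]
    exact ⟨fun hv ↦ ⟨.inl hv, hVB v hv.1⟩, fun hv ↦ hv.1.resolve_right hv.2⟩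
  rw [hA]
  exact .glue r B G₀ ε H _ c G hrake.memR hHP hlε hglue

/-- Induction on the number of vertices: a low set misses `r`, hence is strictly smaller. -/
theorem memP_exactSet [Infinite α] {G : Graft α β} {F : Set β} {r : α}
    (h : G.graph.IsReached F r) (hF : G.IsJoin F) : MemP r (G.graph.exactSet F r) G := by
  induction hn : V(G.graph).ncard using Nat.strong_induction_on generalizing G F r with
  | _ n ih =>
    subst hn
    refine memP_exactSet_of_pieces h hF fun e₀ he₀ c hl₀ ↦ ?_
    obtain ⟨H, hHg, hHT, hHF⟩ := exists_piece h hF he₀ hl₀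
    refine ⟨H, hHg, hHT, ih _ ?_ ?_ hHF rfl⟩
    · rw [hHg]
      exact h.ncard_lowSet_lt G.finite_vertexSet
    · rw [hHg]
      exact h.induce he₀ hl₀

/-- The graph induced on the reached vertices carries all of `F` and `T`, so it plays the part of
`G'`; the remaining vertices, possibly none, form `H`. -/
theorem IsConnectedMinimumJoin.exists_isJoining [Infinite α] {G : Graft α β} {F : Set β} {r : α}
    (h : G.IsConnectedMinimumJoin F) (hr : G.graph.Covers F r) :
    ∃ (G' H : Graft α β) (A : Set α), A ⊆ V(G'.graph) ∧ r ∈ A ∧ MemP r A G' ∧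
      H.T = ∅ ∧ IsJoining G' A H G := by
  classical
  obtain ⟨hmin, -, hconn⟩ := h
  have hJ := isJoin_iff_boundary.1 hmin.1
  have hcons := hmin.isConservative
  have hroot := Graph.IsRooted.of_isConnected hconn hr
  have hrV : r ∈ V(G.graph) := by
    obtain ⟨e, -, he⟩ := hr
    exact he.vertex_mem
  set R := G.graph.reachSet F r with hR
  have hRV : R ⊆ V(G.graph) := Graph.reachSet_subset hrV
  have hle : G.graph.induce R ≤ G.graph := Graph.induce_le hRV
  have hFR : ∀ e ∈ F, ∀ x, G.graph.Inc e x → x ∈ R := fun e he x hx ↦ by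
    obtain ⟨Q, hQ⟩ := hroot.exists_treeWalk he hx
    exact ⟨_, _, .start hQ⟩
  have hFE : F ⊆ E(G.graph.induce R) := fun e he ↦ by
    obtain ⟨x, y, hl⟩ := G.graph.exists_isLink_of_mem_edgeSet (hJ.1 he)
    exact ⟨x, y, hl, hFR e he x hl.inc_left, hFR e he y hl.inc_right⟩
  have hFi : F ∩ E(G.graph.induce R) = F := Set.inter_eq_left.2 hFE
  have hTR : G.T ⊆ R := fun v hv ↦ by
    obtain ⟨e, he, heF⟩ := nonempty_cut_inter_of_boundary (G := G.graph) (F := F) (v := v)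
      (by rw [hJ.2 v (G.T_subset hv), if_pos hv])
    obtain ⟨y, -, hl⟩ := Graph.mem_cut_singleton.1 he
    exact hFR e heF v hl.inc_left
  have hbd : ∀ v ∈ V(G.graph.induce R), (G.graph.induce R).boundary F v =
      if v ∈ G.T then 1 else 0 := fun v hv ↦ by
    rw [Graph.boundary_of_le hle hFE, hJ.2 v (hRV hv)]
  have hreached : (G.graph.induce R).IsReached F r :=
    { root_mem := Graph.root_mem_reachSet
      finite_edgeSet := G.finite_edgeSet.subset hle.edgeSet_mono
      subset := hFE
      conservative := by
        have := hcons.of_le hle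
        rwa [hFi] at this
      exists_treeWalk := fun e he x hx ↦ by
        obtain ⟨Q, hQ⟩ := hroot.exists_treeWalk he (hx.mono hle)
        have := hQ.treeWalk_induce
        rw [← hR, hFi] at this
        exact ⟨Q, this⟩
      reach := by
        rintro v ⟨k, D, hD⟩
        have := hD.climb_induce_reachSet
        rw [← hR, hFi] at this
        exact ⟨k, D, this⟩ }
  let G' : Graft α β := ofBoundary (G.graph.induce R) F G.T (G.finite_vertexSet.subset hRV)
    (G.finite_edgeSet.subset hle.edgeSet_mono) hFE hTR hbd
  have hle' : G.graph.induce (V(G.graph) \ R) ≤ G.graph := Graph.induce_le Set.sdiff_subset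
  let H : Graft α β :=
    { graph := G.graph.induce (V(G.graph) \ R)
      T := ∅
      finite_vertexSet := G.finite_vertexSet.subset Set.sdiff_subset
      finite_edgeSet := G.finite_edgeSet.subset hle'.edgeSet_mono
      T_subset := Set.empty_subset _
      even_component := by simp }
  -- Such an edge is outside `F`. If `u` had a walk of negative length, one more step would reach
  -- `v` with length at most 0.
  have hout : ∀ e u v, G.graph.IsLink e u v → u ∈ R → v ∉ R →
      e ∈ G.graph.edgesBetween ((G.graph.induce R).exactSet F r) (V(G.graph) \ R) := by
    intro e u v hl hu hv
    refine ⟨u, ⟨hu, ?_⟩, v, ⟨hl.right_mem, hv⟩, hl⟩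
    have heF : e ∉ F := fun he ↦ hv (hFR e he v hl.inc_right)
    rintro ⟨k, D, hD⟩
    have hlift : ∀ {k u D}, (G.graph.induce R).Climb F ((G.graph.induce R).TreeWalk F r) k u D →
        G.graph.Climb F (G.graph.TreeWalk F r) k u D := by
      intro k u D hD
      induction hD with
      | start hQ =>
        refine .start ?_
        induction hQ with
        | refl => exact .refl
        | step _ he hl ih => exact ih.step he hl.1
      | step _ he hl ih => exact ih.step he hl.1
    exact hv ⟨k, _, (hlift hD).step heF hl⟩
  refine ⟨G', H, (G.graph.induce R).exactSet F r, fun v hv ↦ hv.1, hreached.root_mem_exactSet,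
    memP_exactSet (G := G') hreached (isJoin_iff_boundary.2 ⟨hFE, hbd⟩), rfl, ?_⟩
  refine ⟨hle, hle', Set.disjoint_sdiff_right, (Set.union_sdiff_cancel hRV).symm, ?_, rfl⟩
  rintro e ⟨he, hne⟩
  obtain ⟨x, y, hl⟩ := G.graph.exists_isLink_of_mem_edgeSet he
  by_cases hx : x ∈ R <;> by_cases hy : y ∈ R
  · exact (hne (.inl ⟨x, y, hl, hx, hy⟩)).elim
  · exact hout e x y hl hx hy
  · exact hout e y x hl.symm hy hx
  · exact (hne (.inr ⟨x, y, hl, ⟨hl.left_mem, hx⟩, hl.right_mem, hy⟩)).elim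

end Graft

theorem mainTheorem1 {α β : Type*} [Infinite α] (G : Graft α β) (hT : G.T.Nonempty)
    (r : α) (hr : r ∈ V(G.graph)) :
    (∃ F : Set β, G.IsConnectedMinimumJoin F ∧ G.graph.Covers F r) ↔
      ((∃ A : Set α, A ⊆ V(G.graph) ∧ r ∈ A ∧ Graft.MemP r A G) ∨
        ∃ (G' H : Graft α β) (A : Set α), A ⊆ V(G'.graph) ∧ r ∈ A ∧ Graft.MemP r A G' ∧
          H.T = ∅ ∧ Graft.IsJoining G' A H G) := by
  constructor
  · rintro ⟨F, hF, hFr⟩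
    exact .inr (hF.exists_isJoining hFr)
  · rintro (⟨A, -, -, hP⟩ | ⟨G', H, A, -, -, hP, -, hJ⟩)
    -- The first alternative is the second one with an empty graph added.
    · let H : Graft α β :=
        { graph := ⊥
          T := ∅
          finite_vertexSet := by simp
          finite_edgeSet := by simp
          T_subset := Set.empty_subset _
          even_component := by simp }
      refine Graft.IsJoining.exists_connected_minimumJoin (H := H) hP.hasRootedJoin ?_ hT
      refine ⟨le_rfl, bot_le, ?_, ?_, ?_, rfl⟩
      · simp [H]
      · simp [H]
      · simp [H]
    · exact hJ.exists_connected_minimumJoin hP.hasRootedJoin hT
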